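/- Let $G$ be a finite graph whose vertices are coloured with two colours in an unknown way. A majority vertex of a colouring is a vertex whose colour class contains more than half of all vertices. A query is an edge of $G$; its answer tells whether the two endpoints have the same colour or different colours. Queries are asked adaptively by a deterministic algorithm, that is, each query may depend on the earlier answers. The algorithm solves the majority problem on $G$ if, for every $2$-colouring, it halts and either outputs a majority vertex or correctly reports that there is none. Let $m(G)$ be the minimum, over all algorithms that solve the majority problem on $G$, of the worst-case number of queries over all $2$-colourings ($m(G)=\infty$ if no algorithm solves it). For every tree $T$ on an even number $n$ of vertices, $m(T)=n-1$. For every tree $T$ on an odd number $n$ of vertices, $m(T)$ is finite and $m(T)\ge n-65$. -/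

import Mathlib

/-- A deterministic adaptive algorithm on a graph `G`, written as a decision tree. It either halts
and outputs a vertex (`some v`) or the verdict that there is no majority vertex (`none`), or it
queries an edge of `G` and continues according to whether the ends have the same colour or
different colours. -/
inductive QueryAlgorithm {V : Type*} (G : SimpleGraph V) where
  | halt (output : Option V) : QueryAlgorithm G
  | query (u v : V) (huv : G.Adj u v) (same diff : QueryAlgorithm G) : QueryAlgorithm G

namespace QueryAlgorithm

variable {V : Type*} {G : SimpleGraph V}

/-- The output of the algorithm when the unknown colouring is `c`. -/
def output (c : V → Bool) : QueryAlgorithm G → Option V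
  | halt o => o
  | query u v _ same diff => if c u = c v then same.output c else diff.output c

/-- The number of queries that the algorithm asks when the unknown colouring is `c`. -/
def queryCount (c : V → Bool) : QueryAlgorithm G → ℕ
  | halt _ => 0
  | query u v _ same diff => (if c u = c v then same.queryCount c else diff.queryCount c) + 1

end QueryAlgorithm

/-- `v` is a majority vertex of the 2-colouring `c`: its colour class contains more than half of
all vertices. -/
def IsMajorityVertex {V : Type*} [Fintype V] (c : V → Bool) (v : V) : Prop :=
  Fintype.card V < 2 * (Finset.univ.filter fun u => c u = c v).card

/-- `o` is a correct solution of the majority problem for the colouring `c`. -/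
def IsMajorityAnswer {V : Type*} [Fintype V] (c : V → Bool) : Option V → Prop
  | some v => IsMajorityVertex c v
  | none => ∀ v, ¬ IsMajorityVertex c v

/-- The algorithm solves the majority problem: its output is correct for every 2-colouring. -/
def QueryAlgorithm.SolvesMajority {V : Type*} [Fintype V] {G : SimpleGraph V}
    (A : QueryAlgorithm G) : Prop :=
  ∀ c : V → Bool, IsMajorityAnswer c (A.output c)

/-- `m(G)`: the least number of queries, in the worst case over all 2-colourings, of an algorithm
that solves the majority problem on `G`; it is `⊤` if no algorithm solves it. -/
noncomputable def majorityNumber {V : Type*} [Fintype V] (G : SimpleGraph V) : ℕ∞ :=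
  ⨅ (A : QueryAlgorithm G) (_ : A.SolvesMajority), ⨆ c : V → Bool, (A.queryCount c : ℕ∞)

/-!
The answers an algorithm has received so far partition the vertices into blocks inside which the
colouring is known up to exchanging the colours. The only information that matters about a block is
the absolute value of its charge, the difference of the sizes of its two colour classes; a query
between blocks with charges `a` and `b` merges them, and an adversary may choose between the
charges `a + b` and `a - b`. As long as some charge is nonzero and no charge exceeds the sum of
all the others in absolute value, no output can be correct (`Undecided`). So it suffices that the
adversary keeps the position undecided until few blocks remain (`card_le_majorityNumber_add`).
Conversely, the `n - 1` edges of a tree determine the colouring up to exchanging the colours, so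
asking all of them is enough (`SimpleGraph.IsTree.majorityNumber_le`).

**Even order.** The adversary keeps the weight of a block `C` determined by parities
(`staticWeight`): it is `1` if `C` has an odd number of vertices, and otherwise `2` or `0` according
to whether the degree sum of `C` is odd or even. With at least two blocks, every block has degree
sum at least `2 * C.card - 1`, hence at least `2 * C.card` if its weight is zero. As the degrees
of the whole tree sum to `2 * (n - 1)`, two blocks have nonzero weight, and for parity reasons none
of the weights, which are at most two, exceeds the sum of the others.

**Odd order.** Here static weights may fail early: weights `2` and `1` together with any number
of blocks of weight zero decide the majority. Removing a suitable set `B` of at most `n / 20`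
vertices cuts the tree into pieces of fewer than `20` vertices
(`SimpleGraph.IsTree.exists_separator`). Choose a power of two `h` with `2 * h < n < 4 * h`. In
the first phase (`IsAnchored`) the blocks that avoid `B` have their static weight while a block
that meets `B` has a positive weight of at most four times its share of `B`; merges lower the
total weight by at most four, and the phase ends when it reaches `2 * h + 1` or `2 * h + 3`.

In the second phase the position is encoded by the product of the Laurent polynomials
`T ^ a + T ^ (-a)` over the nonzero charges `a`, with coefficients modulo two. A merge splits this
product into the sum of the products for the two possible outcomes, so the adversary can
preserve any additive property of the form "some functional does not vanish". The one used is that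
the terms of positive degree do not vanish modulo `T ^ 8 - 1` (`IsSignBalanced`). It holds at the
beginning of the phase because the product has the factor `T ^ h + T ^ (-h)`
(`evalWeight_posClass_signPoly_mul`). It excludes that one weight exceeds the sum of four or more
other nonzero weights (`evalWeight_posClass_of_dominated`): then the terms of positive degree are
`T ^ d` times a product of at least four factors, each divisible by `T + T⁻¹`, and
`(T + T⁻¹) ^ 4` is `T ^ 4 + T ^ (-4)`. So a decided position has at most four blocks of nonzero
charge. Counting edges as in the even case shows that the blocks of charge zero, all of even degree
sum, then lie in at most three of the pieces (`IsBlockPartition.card_filter_le`); hence there are at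
most `3 * 19` of them, and at most `61` blocks altogether.
-/

set_option linter.unusedSectionVars false

/-! ### Partitions into known components -/

section Game

variable {V : Type*} [Fintype V] [DecidableEq V]

/-- The degree sum of the subgraph of `T` induced on `C`, that is, twice its number of edges. -/
def innerDegree (T : SimpleGraph V) [DecidableRel T.Adj] (C : Finset V) : ℕ :=
  ∑ x ∈ C, (T.neighborFinset x ∩ C).card

/-- A family of blocks partitions the vertex set, and each block spans at least as many edges
as a tree on it would. The blocks that arise from merging along edges of `T` are of this kind. -/
structure IsBlockPartition (T : SimpleGraph V) [DecidableRel T.Adj]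
    (P : Finset (Finset V)) : Prop where
  nonempty : ∀ X ∈ P, X.Nonempty
  disjoint : ∀ X ∈ P, ∀ Y ∈ P, X ≠ Y → Disjoint X Y
  cover : ∀ v, ∃ X ∈ P, v ∈ X
  inner : ∀ X ∈ P, 2 * X.card ≤ innerDegree T X + 2

/-- The family `P` with the blocks `X` and `Y` replaced by their union. -/
def mergeBlocks (P : Finset (Finset V)) (X Y : Finset V) : Finset (Finset V) :=
  insert (X ∪ Y) ((P.erase X).erase Y)

/-- The colourings `c` and `c'` give the same answer to every question inside a block of `P`. -/
def AgreeOn (P : Finset (Finset V)) (c c' : V → Bool) : Prop :=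
  ∀ X ∈ P, ∀ x ∈ X, ∀ y ∈ X, (c' x = c' y ↔ c x = c y)

/-- The sign of a colour. -/
def colourSign (b : Bool) : ℤ := if b then 1 else -1

/-- The difference of the sizes of the two colour classes on the block `C`. -/
def charge (c : V → Bool) (C : Finset V) : ℤ := ∑ x ∈ C, colourSign (c x)

variable {T : SimpleGraph V} [DecidableRel T.Adj] {P : Finset (Finset V)}

theorem innerDegree_union {X Y : Finset V} (h : Disjoint X Y) :
    innerDegree T (X ∪ Y) = innerDegree T X + innerDegree T Y
      + (∑ x ∈ X, (T.neighborFinset x ∩ Y).card) + ∑ x ∈ Y, (T.neighborFinset x ∩ X).card := by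
  unfold innerDegree
  rw [Finset.sum_union h]
  have key : ∀ x, (T.neighborFinset x ∩ (X ∪ Y)).card
      = (T.neighborFinset x ∩ X).card + (T.neighborFinset x ∩ Y).card := by
    intro x
    rw [Finset.inter_union_distrib_left, Finset.card_union_of_disjoint]
    exact h.mono Finset.inter_subset_right Finset.inter_subset_right
  simp only [key, Finset.sum_add_distrib]
  ring

theorem sum_card_neighborFinset_inter_pos {X Y : Finset V} {u v : V} (hu : u ∈ X) (hv : v ∈ Y)
    (h : T.Adj u v) : 1 ≤ ∑ x ∈ X, (T.neighborFinset x ∩ Y).card := by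
  refine le_trans ?_ (Finset.single_le_sum (f := fun x => (T.neighborFinset x ∩ Y).card)
    (fun _ _ => Nat.zero_le _) hu)
  exact Finset.card_pos.2 ⟨v, by simp [hv, h]⟩

theorem prod_eq_mul_mul {M : Type*} [CommMonoid M] {X Y : Finset V} (hX : X ∈ P) (hY : Y ∈ P)
    (hXY : X ≠ Y) (f : Finset V → M) :
    ∏ Z ∈ P, f Z = f X * f Y * ∏ Z ∈ (P.erase X).erase Y, f Z := by
  rw [mul_assoc, Finset.mul_prod_erase _ f (Finset.mem_erase.2 ⟨hXY.symm, hY⟩),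
    Finset.mul_prod_erase _ f hX]

theorem sum_eq_add_add {M : Type*} [AddCommMonoid M]
    {X Y : Finset V} (hX : X ∈ P) (hY : Y ∈ P) (hXY : X ≠ Y) (f : Finset V → M) :
    ∑ Z ∈ P, f Z = f X + f Y + ∑ Z ∈ (P.erase X).erase Y, f Z := by
  rw [add_assoc, Finset.add_sum_erase _ f (Finset.mem_erase.2 ⟨hXY.symm, hY⟩),
    Finset.add_sum_erase _ f hX]

namespace IsBlockPartition

theorem union_notMem (hP : IsBlockPartition T P) {X Y : Finset V} (hX : X ∈ P) :
    X ∪ Y ∉ (P.erase X).erase Y := by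
  intro h
  simp only [Finset.mem_erase] at h
  have hd := hP.disjoint _ h.2.2 _ hX h.2.1
  obtain ⟨x, hx⟩ := hP.nonempty X hX
  exact Finset.disjoint_left.1 hd (Finset.mem_union_left _ hx) hx

theorem prod_mergeBlocks (hP : IsBlockPartition T P) {M : Type*} [CommMonoid M] {X Y : Finset V}
    (hX : X ∈ P) (f : Finset V → M) :
    ∏ Z ∈ mergeBlocks P X Y, f Z = f (X ∪ Y) * ∏ Z ∈ (P.erase X).erase Y, f Z :=
  Finset.prod_insert (hP.union_notMem hX)

theorem sum_mergeBlocks (hP : IsBlockPartition T P) {M : Type*} [AddCommMonoid M]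
    {X Y : Finset V} (hX : X ∈ P) (f : Finset V → M) :
    ∑ Z ∈ mergeBlocks P X Y, f Z = f (X ∪ Y) + ∑ Z ∈ (P.erase X).erase Y, f Z :=
  Finset.sum_insert (hP.union_notMem hX)

theorem card_mergeBlocks (hP : IsBlockPartition T P) {X Y : Finset V} (hX : X ∈ P) (hY : Y ∈ P)
    (hXY : X ≠ Y) : (mergeBlocks P X Y).card + 1 = P.card := by
  rw [mergeBlocks, Finset.card_insert_of_notMem (hP.union_notMem hX),
    Finset.card_erase_add_one (Finset.mem_erase.2 ⟨hXY.symm, hY⟩), Finset.card_erase_add_one hX]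

theorem mergeBlocks (hP : IsBlockPartition T P) {X Y : Finset V} (hX : X ∈ P) (hY : Y ∈ P)
    (hXY : X ≠ Y) {u v : V} (hu : u ∈ X) (hv : v ∈ Y) (huv : T.Adj u v) :
    IsBlockPartition T (mergeBlocks P X Y) := by
  have hd := hP.disjoint X hX Y hY hXY
  constructor
  · intro Z hZ
    rcases Finset.mem_insert.1 hZ with rfl | hZ
    · exact (hP.nonempty X hX).mono Finset.subset_union_left
    · exact hP.nonempty Z (Finset.mem_of_mem_erase (Finset.mem_of_mem_erase hZ))
  · have key : ∀ Z ∈ (P.erase X).erase Y, Disjoint (X ∪ Y) Z := by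
      intro Z hZ
      simp only [Finset.mem_erase] at hZ
      exact Finset.disjoint_union_left.2 ⟨hP.disjoint _ hX _ hZ.2.2 (Ne.symm hZ.2.1),
        hP.disjoint _ hY _ hZ.2.2 (Ne.symm hZ.1)⟩
    intro Z hZ W hW hZW
    rcases Finset.mem_insert.1 hZ with rfl | hZ <;> rcases Finset.mem_insert.1 hW with rfl | hW
    · exact absurd rfl hZW
    · exact key W hW
    · exact (key Z hZ).symm
    · simp only [Finset.mem_erase] at hZ hW
      exact hP.disjoint _ hZ.2.2 _ hW.2.2 hZW
  · intro w
    obtain ⟨Z, hZ, hw⟩ := hP.cover w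
    by_cases h1 : Z = X
    · exact ⟨X ∪ Y, Finset.mem_insert_self _ _, Finset.mem_union_left _ (h1 ▸ hw)⟩
    by_cases h2 : Z = Y
    · exact ⟨X ∪ Y, Finset.mem_insert_self _ _, Finset.mem_union_right _ (h2 ▸ hw)⟩
    · exact ⟨Z, Finset.mem_insert_of_mem (by simp [h1, h2, hZ]), hw⟩
  · intro Z hZ
    rcases Finset.mem_insert.1 hZ with rfl | hZ
    · have h1 := hP.inner X hX
      have h2 := hP.inner Y hY
      have h3 := sum_card_neighborFinset_inter_pos hu hv huv
      have h4 := sum_card_neighborFinset_inter_pos hv hu huv.symm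
      rw [innerDegree_union hd, Finset.card_union_of_disjoint hd]
      omega
    · exact hP.inner Z (Finset.mem_of_mem_erase (Finset.mem_of_mem_erase hZ))

theorem sum_blocks (hP : IsBlockPartition T P) {M : Type*} [AddCommMonoid M] (f : V → M) :
    ∑ X ∈ P, ∑ x ∈ X, f x = ∑ x, f x := by
  rw [← Finset.sum_biUnion fun X hX Y hY h => hP.disjoint X hX Y hY h]
  congr 1
  ext v
  simpa using hP.cover v

end IsBlockPartition

theorem isBlockPartition_singletons :
    IsBlockPartition T (Finset.univ.image fun v : V => ({v} : Finset V)) := by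
  constructor
  · intro X hX
    obtain ⟨v, -, rfl⟩ := Finset.mem_image.1 hX
    exact Finset.singleton_nonempty v
  · intro X hX Y hY h
    obtain ⟨v, -, rfl⟩ := Finset.mem_image.1 hX
    obtain ⟨w, -, rfl⟩ := Finset.mem_image.1 hY
    rw [Finset.disjoint_singleton]
    exact fun e => h (by rw [e])
  · exact fun v => ⟨{v}, Finset.mem_image_of_mem _ (Finset.mem_univ v), Finset.mem_singleton_self v⟩
  · intro X hX
    obtain ⟨v, -, rfl⟩ := Finset.mem_image.1 hX
    simp

theorem card_singletons :
    (Finset.univ.image fun v : V => ({v} : Finset V)).card = Fintype.card V := by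
  rw [Finset.card_image_of_injective _ Finset.singleton_injective, Finset.card_univ]

/-! ### Charges and the choice of signs -/

theorem AgreeOn.refl (c : V → Bool) : AgreeOn P c c := fun _ _ _ _ _ _ => Iff.rfl

theorem AgreeOn.trans_mergeBlocks {c c' c'' : V → Bool} {X Y : Finset V} (h : AgreeOn P c c')
    (h' : AgreeOn (mergeBlocks P X Y) c' c'') : AgreeOn P c c'' := by
  intro Z hZ x hx y hy
  rw [← h Z hZ x hx y hy]
  by_cases h1 : Z = X
  · exact h' (X ∪ Y) (Finset.mem_insert_self _ _) x (Finset.mem_union_left _ (h1 ▸ hx)) y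
      (Finset.mem_union_left _ (h1 ▸ hy))
  by_cases h2 : Z = Y
  · exact h' (X ∪ Y) (Finset.mem_insert_self _ _) x (Finset.mem_union_right _ (h2 ▸ hx)) y
      (Finset.mem_union_right _ (h2 ▸ hy))
  · exact h' Z (Finset.mem_insert_of_mem (by simp [h1, h2, hZ])) x hx y hy

theorem colourSign_not (b : Bool) : colourSign (!b) = -colourSign b := by
  cases b <;> simp [colourSign]

theorem charge_union {c : V → Bool} {X Y : Finset V} (h : Disjoint X Y) :
    charge c (X ∪ Y) = charge c X + charge c Y := Finset.sum_union h

theorem IsBlockPartition.sum_charge (hP : IsBlockPartition T P) (c : V → Bool) :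
    ∑ X ∈ P, charge c X = charge c Finset.univ := hP.sum_blocks _

theorem charge_emod_two (c : V → Bool) (C : Finset V) :
    charge c C % 2 = (C.card : ℤ) % 2 := by
  induction C using Finset.induction_on with
  | empty => rfl
  | insert x C hx ih =>
    have : charge c (insert x C) = colourSign (c x) + charge c C := Finset.sum_insert hx
    rw [this, Finset.card_insert_of_notMem hx]
    unfold colourSign
    push_cast
    split_ifs <;> omega

theorem isMajorityVertex_iff (c : V → Bool) (v : V) :
    IsMajorityVertex c v ↔ 0 < colourSign (c v) * charge c Finset.univ := by
  have key : colourSign (c v) * charge c Finset.univ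
      = 2 * ((Finset.univ.filter fun u => c u = c v).card : ℤ) - Fintype.card V := by
    rw [charge, Finset.mul_sum, Finset.card_filter, Fintype.card]
    push_cast
    rw [Finset.mul_sum, Finset.card_eq_sum_ones]
    push_cast
    rw [← Finset.sum_sub_distrib]
    refine Finset.sum_congr rfl fun u _ => ?_
    cases c u <;> cases c v <;> simp [colourSign]
  rw [key, IsMajorityVertex]
  omega

/-- Reversing the colours on any set of blocks changes no answer inside a block. -/
theorem IsBlockPartition.exists_agreeOn (hP : IsBlockPartition T P) (c : V → Bool)
    (σ : Finset V → Bool) : ∃ c', AgreeOn P c c' ∧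
      ∀ X ∈ P, ∀ x ∈ X, c' x = if σ X then c x else !c x := by
  choose b hb hvb using hP.cover
  have hbX : ∀ X ∈ P, ∀ x ∈ X, b x = X := by
    intro X hX x hx
    by_contra h
    exact Finset.disjoint_left.1 (hP.disjoint _ (hb x) _ hX h) (hvb x) hx
  refine ⟨fun x => if σ (b x) then c x else !c x, ?_, ?_⟩
  · intro X hX x hx y hy
    simp only [hbX X hX x hx, hbX X hX y hy]
    cases σ X <;> simp
  · intro X hX x hx
    simp only [hbX X hX x hx]

theorem charge_of_forall {c c' : V → Bool} {X : Finset V} {b : Bool}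
    (h : ∀ x ∈ X, c' x = if b then c x else !c x) :
    charge c' X = if b then charge c X else -charge c X := by
  cases b
  · simp only [Bool.false_eq_true, if_false] at h ⊢
    rw [charge, charge, ← Finset.sum_neg_distrib]
    exact Finset.sum_congr rfl fun x hx => by rw [h x hx, colourSign_not]
  · simp only [if_true] at h ⊢
    exact Finset.sum_congr rfl fun x hx => by rw [h x hx]

theorem IsBlockPartition.exists_agreeOn_charge (hP : IsBlockPartition T P) {X Y : Finset V}
    (hX : X ∈ P) (hY : Y ∈ P) (hXY : X ≠ Y) (c : V → Bool) (s : Bool) : ∃ c', AgreeOn P c c' ∧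
      charge c' (X ∪ Y) = (if s then charge c X + charge c Y else charge c X - charge c Y) ∧
      ∀ Z ∈ (P.erase X).erase Y, charge c' Z = charge c Z := by
  obtain ⟨c', h1, h2⟩ := hP.exists_agreeOn c fun Z => if Z = Y then s else true
  have h3 : ∀ Z ∈ P, charge c' Z = if (if Z = Y then s else true) then charge c Z
      else -charge c Z := fun Z hZ => charge_of_forall (h2 Z hZ)
  refine ⟨c', h1, ?_, ?_⟩
  · rw [charge_union (hP.disjoint X hX Y hY hXY), h3 X hX, h3 Y hY]
    cases s <;> simp [hXY, sub_eq_add_neg]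
  · intro Z hZ
    simp only [Finset.mem_erase] at hZ
    simp [h3 Z hZ.2.2, hZ.1]

/-- What the answers inside the blocks leave open: some charge is nonzero, and no block
outweighs all the others together. -/
def Undecided (P : Finset (Finset V)) (c : V → Bool) : Prop :=
  (∃ X ∈ P, charge c X ≠ 0) ∧
    ∀ D ∈ P, (charge c D).natAbs ≤ ∑ X ∈ P.erase D, (charge c X).natAbs

/-- In an undecided position no output is correct for all colourings that are still possible. -/
theorem Undecided.exists_not_isMajorityAnswer {c : V → Bool} (h : Undecided P c)
    (hP : IsBlockPartition T P) (o : Option V) :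
    ∃ c', AgreeOn P c c' ∧ ¬ IsMajorityAnswer c' o := by
  cases o with
  | none =>
    obtain ⟨X, hX, hne⟩ := h.1
    obtain ⟨c', h1, h2⟩ := hP.exists_agreeOn c fun Z => decide (0 ≤ charge c Z)
    have h3 : ∀ Z ∈ P, charge c' Z = |charge c Z| := by
      intro Z hZ
      rw [charge_of_forall (h2 Z hZ)]
      by_cases h0 : 0 ≤ charge c Z
      · simp [h0, abs_of_nonneg h0]
      · simp [h0, abs_of_neg (not_le.1 h0)]
    have hpos : 0 < charge c' Finset.univ := by
      rw [← hP.sum_charge, Finset.sum_congr rfl h3]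
      exact Finset.sum_pos' (fun _ _ => abs_nonneg _) ⟨X, hX, abs_pos.2 hne⟩
    refine ⟨c', h1, fun hno => ?_⟩
    have hv : ∃ v, c' v = true := by
      by_contra! hv
      refine absurd hpos (not_lt.2 (Finset.sum_nonpos fun v _ => ?_))
      simp [colourSign, hv v]
    obtain ⟨v, hv⟩ := hv
    exact hno v ((isMajorityVertex_iff c' v).2 (by simpa [hv, colourSign] using hpos))
  | some v =>
    obtain ⟨D, hD, hv⟩ := hP.cover v
    have hle := h.2 D hD
    obtain ⟨c', h1, h2⟩ := hP.exists_agreeOn c fun Z =>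
      decide (Z = D ∨ colourSign (c v) * charge c Z ≤ 0)
    have hcv : c' v = c v := by simpa using h2 D hD v hv
    have hsq : ∀ b z, |colourSign b * z| = |z| := by
      intro b z
      cases b <;> simp [colourSign]
    have h3 : ∀ Z ∈ P.erase D, colourSign (c v) * charge c' Z = -|charge c Z| := by
      intro Z hZ
      rw [Finset.mem_erase] at hZ
      rw [charge_of_forall (h2 Z hZ.2), ← hsq (c v)]
      by_cases h0 : colourSign (c v) * charge c Z ≤ 0
      · simp [h0, abs_of_nonpos h0]
      · simp [h0, hZ.1, abs_of_pos (not_le.1 h0)]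
    have h4 : charge c' D = charge c D := by simpa using charge_of_forall (h2 D hD)
    refine ⟨c', h1, fun hmaj => ?_⟩
    have hpos := (isMajorityVertex_iff c' v).1 hmaj
    rw [← hP.sum_charge, ← Finset.add_sum_erase _ _ hD, mul_add, Finset.mul_sum, hcv,
      Finset.sum_congr rfl h3, h4, Finset.sum_neg_distrib] at hpos
    have h5 : colourSign (c v) * charge c D ≤ |charge c D| := by
      rw [← hsq (c v)]; exact le_abs_self _
    have h6 : |charge c D| ≤ ∑ X ∈ P.erase D, |charge c X| := by
      simp only [Int.abs_eq_natAbs]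
      exact_mod_cast hle
    linarith

/-! ### The adversary argument -/

/-- If an adversary can keep a property `Good` of the position whenever two blocks merge, and
good positions with more than `N` blocks are undecided, then an algorithm that is correct from
a good position on asks at least `P.card - N` queries on some colouring. -/
theorem exists_queryCount_ge {N : ℕ} (Good : Finset (Finset V) → (V → Bool) → Prop)
    (step : ∀ P c, IsBlockPartition T P → Good P c → ∀ X ∈ P, ∀ Y ∈ P, X ≠ Y →
      ∀ u ∈ X, ∀ v ∈ Y, T.Adj u v → ∃ c', AgreeOn P c c' ∧ Good (mergeBlocks P X Y) c')
    (undec : ∀ P c, IsBlockPartition T P → Good P c → N < P.card → Undecided P c)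
    (A : QueryAlgorithm T) (P : Finset (Finset V)) (c : V → Bool) (hP : IsBlockPartition T P)
    (hc : Good P c) (hA : ∀ c', AgreeOn P c c' → IsMajorityAnswer c' (A.output c')) :
    ∃ c', AgreeOn P c c' ∧ P.card ≤ A.queryCount c' + N := by
  induction A generalizing P c with
  | halt o =>
    refine ⟨c, AgreeOn.refl c, ?_⟩
    by_contra! hN
    obtain ⟨c', h1, h2⟩ := (undec P c hP hc (by omega)).exists_not_isMajorityAnswer hP o
    exact h2 (hA c' h1)
  | query u v huv same diff ihs ihd =>
    obtain ⟨X, hX, hu⟩ := hP.cover u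
    obtain ⟨Y, hY, hv⟩ := hP.cover v
    by_cases hXY : X = Y
    · subst hXY
      by_cases huv' : c u = c v
      · obtain ⟨c', h1, h2⟩ := ihs P c hP hc fun c' h => by
          have := hA c' h
          rwa [QueryAlgorithm.output, if_pos ((h X hX u hu v hv).2 huv')] at this
        refine ⟨c', h1, ?_⟩
        rw [QueryAlgorithm.queryCount, if_pos ((h1 X hX u hu v hv).2 huv')]
        omega
      · obtain ⟨c', h1, h2⟩ := ihd P c hP hc fun c' h => by
          have := hA c' h
          rwa [QueryAlgorithm.output, if_neg fun e => huv' ((h X hX u hu v hv).1 e)] at this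
        refine ⟨c', h1, ?_⟩
        rw [QueryAlgorithm.queryCount, if_neg fun e => huv' ((h1 X hX u hu v hv).1 e)]
        omega
    · obtain ⟨c₁, hag, hgood⟩ := step P c hP hc X hX Y hY hXY u hu v hv huv
      have hcard := hP.card_mergeBlocks hX hY hXY
      have hP' := hP.mergeBlocks hX hY hXY hu hv huv
      have hmem : X ∪ Y ∈ mergeBlocks P X Y := Finset.mem_insert_self _ _
      have hu' : u ∈ X ∪ Y := Finset.mem_union_left _ hu
      have hv' : v ∈ X ∪ Y := Finset.mem_union_right _ hv
      by_cases huv' : c₁ u = c₁ v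
      · obtain ⟨c', h1, h2⟩ := ihs _ c₁ hP' hgood fun c' h => by
          have := hA c' (hag.trans_mergeBlocks h)
          rwa [QueryAlgorithm.output, if_pos ((h _ hmem u hu' v hv').2 huv')] at this
        refine ⟨c', hag.trans_mergeBlocks h1, ?_⟩
        rw [QueryAlgorithm.queryCount, if_pos ((h1 _ hmem u hu' v hv').2 huv')]
        omega
      · obtain ⟨c', h1, h2⟩ := ihd _ c₁ hP' hgood fun c' h => by
          have := hA c' (hag.trans_mergeBlocks h)
          rwa [QueryAlgorithm.output, if_neg fun e => huv' ((h _ hmem u hu' v hv').1 e)] at this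
        refine ⟨c', hag.trans_mergeBlocks h1, ?_⟩
        rw [QueryAlgorithm.queryCount, if_neg fun e => huv' ((h1 _ hmem u hu' v hv').1 e)]
        omega

theorem card_le_majorityNumber_add {N : ℕ} (Good : Finset (Finset V) → (V → Bool) → Prop)
    (step : ∀ P c, IsBlockPartition T P → Good P c → ∀ X ∈ P, ∀ Y ∈ P, X ≠ Y →
      ∀ u ∈ X, ∀ v ∈ Y, T.Adj u v → ∃ c', AgreeOn P c c' ∧ Good (mergeBlocks P X Y) c')
    (undec : ∀ P c, IsBlockPartition T P → Good P c → N < P.card → Undecided P c)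
    (c : V → Bool) (init : Good (Finset.univ.image fun v : V => ({v} : Finset V)) c) :
    (Fintype.card V : ℕ∞) ≤ majorityNumber T + N := by
  rw [← tsub_le_iff_right]
  refine le_iInf₂ fun A hA => ?_
  obtain ⟨c', -, h⟩ := exists_queryCount_ge Good step undec A _ c isBlockPartition_singletons init
    fun c' _ => hA c'
  rw [card_singletons] at h
  rw [tsub_le_iff_right]
  refine le_trans (b := (A.queryCount c' : ℕ∞) + N) (by exact_mod_cast h) ?_
  gcongr
  exact le_iSup (fun c => (A.queryCount c : ℕ∞)) c'

end Game

/-! ### Degree sums in trees -/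

section Degrees

variable {V : Type*} [Fintype V] [DecidableEq V] {T : SimpleGraph V} [DecidableRel T.Adj]
  {P : Finset (Finset V)}

/-- The sum of the degrees, in the whole graph `T`, of the vertices of `C`. -/
def degreeSum (T : SimpleGraph V) [DecidableRel T.Adj] (C : Finset V) : ℕ := ∑ x ∈ C, T.degree x

theorem degreeSum_union {X Y : Finset V} (h : Disjoint X Y) :
    degreeSum T (X ∪ Y) = degreeSum T X + degreeSum T Y := Finset.sum_union h

theorem degreeSum_eq_innerDegree_add (C : Finset V) :
    degreeSum T C = innerDegree T C + ∑ x ∈ C, (T.neighborFinset x ∩ Cᶜ).card := by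
  rw [innerDegree, ← Finset.sum_add_distrib]
  refine Finset.sum_congr rfl fun x _ => ?_
  rw [← Finset.card_union_of_disjoint, ← Finset.inter_union_distrib_left, Finset.union_compl,
    Finset.inter_univ, T.card_neighborFinset_eq_degree]
  exact disjoint_compl_right.mono Finset.inter_subset_right Finset.inter_subset_right

theorem sum_card_neighborFinset_inter_comm (X Y : Finset V) :
    ∑ x ∈ X, (T.neighborFinset x ∩ Y).card = ∑ y ∈ Y, (T.neighborFinset y ∩ X).card := by
  have key : ∀ (x : V) (Z : Finset V), (T.neighborFinset x ∩ Z).card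
      = ∑ z ∈ Z, if T.Adj x z then 1 else 0 := by
    intro x Z
    rw [← Finset.card_filter]
    congr 1
    ext z
    simp [and_comm]
  simp only [key]
  rw [Finset.sum_comm]
  simp only [T.adj_comm]

theorem innerDegree_univ : innerDegree T Finset.univ = degreeSum T Finset.univ := by
  simp [innerDegree, degreeSum]

theorem SimpleGraph.IsTree.degreeSum_univ (hT : T.IsTree) :
    degreeSum T Finset.univ + 2 = 2 * Fintype.card V := by
  rw [degreeSum, T.sum_degrees_eq_twice_card_edges, ← hT.card_edgeFinset]
  ring

theorem SimpleGraph.Connected.exists_adj_boundary (hT : T.Connected) {C : Finset V}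
    (hC : C.Nonempty) (hC' : C ≠ Finset.univ) : ∃ x ∈ C, ∃ y ∉ C, T.Adj x y := by
  obtain ⟨x, hx⟩ := hC
  obtain ⟨y, hy⟩ : ∃ y, y ∉ C := by
    by_contra! h
    exact hC' (Finset.eq_univ_iff_forall.2 h)
  obtain ⟨w⟩ := hT.preconnected x y
  obtain ⟨d, -, h1, h2⟩ := w.exists_boundary_dart (C : Set V) (by simpa using hx)
    (by simpa using hy)
  exact ⟨d.fst, by simpa using h1, d.snd, by simpa using h2, d.adj⟩

theorem SimpleGraph.Connected.innerDegree_lt_degreeSum (hT : T.Connected) {C : Finset V}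
    (hC : C.Nonempty) (hC' : C ≠ Finset.univ) : innerDegree T C < degreeSum T C := by
  obtain ⟨x, hx, y, hy, h⟩ := hT.exists_adj_boundary hC hC'
  have := sum_card_neighborFinset_inter_pos hx (Finset.mem_compl.2 hy) h
  rw [degreeSum_eq_innerDegree_add]
  omega

/-- A nonempty set of vertices of a tree spans a forest: grow it, one adjacent vertex at a time,
to the whole tree. -/
theorem SimpleGraph.IsTree.innerDegree_add_two_le (hT : T.IsTree) {U : Finset V}
    (hU : U.Nonempty) : innerDegree T U + 2 ≤ 2 * U.card := by
  by_cases h : U = Finset.univ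
  · rw [h, innerDegree_univ, hT.degreeSum_univ, Finset.card_univ]
  · obtain ⟨x, hx, y, hy, hxy⟩ := hT.connected.exists_adj_boundary hU h
    have hd : Disjoint U {y} := Finset.disjoint_singleton_right.2 hy
    have hlt : Fintype.card V - (U ∪ {y}).card < Fintype.card V - U.card := by
      have h1 : U.card < Fintype.card V := Finset.card_lt_univ_of_notMem hy
      rw [Finset.card_union_of_disjoint hd, Finset.card_singleton]
      omega
    have ih := SimpleGraph.IsTree.innerDegree_add_two_le (U := U ∪ {y}) hT
      (hU.mono Finset.subset_union_left)
    have h2 := sum_card_neighborFinset_inter_pos (Y := {y}) hx (Finset.mem_singleton_self y) hxy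
    have h3 := sum_card_neighborFinset_inter_pos (X := {y}) (Finset.mem_singleton_self y) hx
      hxy.symm
    rw [innerDegree_union hd, Finset.card_union_of_disjoint hd, Finset.card_singleton] at ih
    omega
termination_by Fintype.card V - U.card
decreasing_by simpa [Finset.union_comm] using hlt

namespace IsBlockPartition

theorem ne_univ (hP : IsBlockPartition T P) (h : 1 < P.card) {X : Finset V} (hX : X ∈ P) :
    X ≠ Finset.univ := by
  rintro rfl
  obtain ⟨Y, hY, hne⟩ := Finset.exists_mem_ne h Finset.univ
  obtain ⟨y, hy⟩ := hP.nonempty Y hY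
  exact Finset.disjoint_left.1 (hP.disjoint _ hY _ hX hne) hy (Finset.mem_univ y)

theorem two_mul_card_le (hP : IsBlockPartition T P) (hT : T.Connected) (h : 1 < P.card)
    {X : Finset V} (hX : X ∈ P) : 2 * X.card ≤ degreeSum T X + 1 := by
  have h1 := hP.inner X hX
  have h2 := hT.innerDegree_lt_degreeSum (hP.nonempty X hX) (hP.ne_univ h hX)
  omega

theorem sum_card (hP : IsBlockPartition T P) : ∑ X ∈ P, X.card = Fintype.card V := by
  have h := hP.sum_blocks fun _ => 1
  simp only [← Finset.card_eq_sum_ones] at h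
  exact h

theorem sum_degreeSum (hP : IsBlockPartition T P) :
    ∑ X ∈ P, degreeSum T X = degreeSum T Finset.univ := hP.sum_blocks _

end IsBlockPartition

theorem natAbs_charge_mod_two (c : V → Bool) (C : Finset V) :
    (charge c C).natAbs % 2 = C.card % 2 := by
  have := charge_emod_two c C
  omega

theorem IsBlockPartition.sum_natAbs_charge_mod_two (hP : IsBlockPartition T P) (c : V → Bool) :
    (∑ X ∈ P, (charge c X).natAbs) % 2 = Fintype.card V % 2 := by
  rw [← hP.sum_card, Finset.sum_nat_mod, Finset.sum_congr rfl fun X _ => natAbs_charge_mod_two c X,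
    ← Finset.sum_nat_mod]

/-! ### Weights determined by parities -/

/-- The weight that the adversary gives to a block by default. It depends only on the parities of
the number of vertices and of the degree sum, so it is insensitive to the order of the merges. -/
def staticWeight (T : SimpleGraph V) [DecidableRel T.Adj] (C : Finset V) : ℕ :=
  if Even C.card then if Even (degreeSum T C) then 0 else 2 else 1

theorem staticWeight_le_two (C : Finset V) : staticWeight T C ≤ 2 := by
  unfold staticWeight
  split_ifs <;> omega

theorem staticWeight_eq_zero_iff {C : Finset V} :
    staticWeight T C = 0 ↔ Even C.card ∧ Even (degreeSum T C) := by
  unfold staticWeight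
  split_ifs with h1 h2 <;> simp [*]

theorem staticWeight_union {X Y : Finset V} (h : Disjoint X Y) {a b : ℤ}
    (ha : a.natAbs = staticWeight T X) (hb : b.natAbs = staticWeight T Y) :
    (a + b).natAbs = staticWeight T (X ∪ Y) ∨ (a - b).natAbs = staticWeight T (X ∪ Y) := by
  unfold staticWeight at *
  rw [Finset.card_union_of_disjoint h, degreeSum_union h]
  simp only [Nat.even_add]
  by_cases h1 : Even X.card <;> by_cases h2 : Even Y.card <;>
    by_cases h3 : Even (degreeSum T X) <;> by_cases h4 : Even (degreeSum T Y) <;>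
    simp only [h1, h2, h3, h4, if_true, if_false] at ha hb ⊢ <;> simp <;> omega

theorem exists_agreeOn_staticWeight (hP : IsBlockPartition T P) {X Y : Finset V}
    (hX : X ∈ P) (hY : Y ∈ P) (hXY : X ≠ Y) {c : V → Bool}
    (hcX : (charge c X).natAbs = staticWeight T X) (hcY : (charge c Y).natAbs = staticWeight T Y) :
    ∃ c', AgreeOn P c c' ∧ (charge c' (X ∪ Y)).natAbs = staticWeight T (X ∪ Y) ∧
      ∀ Z ∈ (P.erase X).erase Y, charge c' Z = charge c Z := by
  rcases staticWeight_union (hP.disjoint X hX Y hY hXY) hcX hcY with h | h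
  · obtain ⟨c', h1, h2, h3⟩ := hP.exists_agreeOn_charge hX hY hXY c true
    exact ⟨c', h1, by rw [h2]; simpa using h, h3⟩
  · obtain ⟨c', h1, h2, h3⟩ := hP.exists_agreeOn_charge hX hY hXY c false
    exact ⟨c', h1, by rw [h2]; simpa using h, h3⟩

theorem natAbs_charge_singleton (c : V → Bool) (v : V) : (charge c {v}).natAbs = 1 := by
  rw [charge, Finset.sum_singleton, colourSign]
  split_ifs <;> rfl

theorem IsBlockPartition.undecided_of_staticWeight (hP : IsBlockPartition T P) (hT : T.IsTree)
    (hn : Even (Fintype.card V)) {c : V → Bool}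
    (hc : ∀ X ∈ P, (charge c X).natAbs = staticWeight T X) (h : 1 < P.card) : Undecided P c := by
  have hsum : 2 * Fintype.card V
      ≤ degreeSum T Finset.univ + (P.filter fun X => charge c X ≠ 0).card := by
    rw [← hP.sum_card, ← hP.sum_degreeSum, Finset.mul_sum, Finset.card_filter,
      ← Finset.sum_add_distrib]
    refine Finset.sum_le_sum fun X hX => ?_
    have h1 := hP.two_mul_card_le hT.connected h hX
    split_ifs with h0
    · exact h1
    · have h2 := hc X hX
      rw [not_not.1 h0, Int.natAbs_zero, eq_comm, staticWeight_eq_zero_iff] at h2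
      obtain ⟨r, hr⟩ := h2.2
      omega
  have htwo : 1 < (P.filter fun X => charge c X ≠ 0).card := by
    have := hT.degreeSum_univ
    omega
  obtain ⟨X, hX⟩ := Finset.card_pos.1 (zero_lt_one.trans htwo)
  refine ⟨⟨X, (Finset.mem_filter.1 hX).1, (Finset.mem_filter.1 hX).2⟩, fun D hD => ?_⟩
  obtain ⟨Z, hZ, hne⟩ := Finset.exists_mem_ne htwo D
  rw [Finset.mem_filter] at hZ
  have hle : (charge c Z).natAbs ≤ ∑ X ∈ P.erase D, (charge c X).natAbs :=
    Finset.single_le_sum (f := fun X => (charge c X).natAbs) (fun _ _ => Nat.zero_le _)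
      (Finset.mem_erase.2 ⟨hne, hZ.1⟩)
  have hpar := hP.sum_natAbs_charge_mod_two c
  rw [← Finset.add_sum_erase _ _ hD] at hpar
  have h2 : (charge c D).natAbs ≤ 2 := hc D hD ▸ staticWeight_le_two D
  have h3 : 0 < (charge c Z).natAbs := Int.natAbs_pos.2 hZ.2
  obtain ⟨r, hr⟩ := hn
  omega

theorem SimpleGraph.IsTree.card_le_majorityNumber_add_one (hT : T.IsTree)
    (hn : Even (Fintype.card V)) : (Fintype.card V : ℕ∞) ≤ majorityNumber T + 1 := by
  refine card_le_majorityNumber_add (N := 1)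
    (fun P c => ∀ X ∈ P, (charge c X).natAbs = staticWeight T X) ?_
    (fun P c hP hc h => hP.undecided_of_staticWeight hT hn hc h) (fun _ => true) ?_
  · intro P c hP hc X hX Y hY hXY u _ v _ _
    obtain ⟨c', h1, h2, h3⟩ := exists_agreeOn_staticWeight hP hX hY hXY (hc X hX) (hc Y hY)
    refine ⟨c', h1, fun Z hZ => ?_⟩
    rcases Finset.mem_insert.1 hZ with rfl | hZ
    · exact h2
    · rw [h3 Z hZ]
      exact hc Z (Finset.mem_of_mem_erase (Finset.mem_of_mem_erase hZ))
  · intro X hX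
    obtain ⟨v, -, rfl⟩ := Finset.mem_image.1 hX
    rw [natAbs_charge_singleton, staticWeight]
    simp

end Degrees

/-! ### Upper bound: asking all edges -/

section UpperBound

variable {V : Type*} [Fintype V] {T : SimpleGraph V}

open Classical in
/-- The algorithm that asks the edges of a list one after the other, when only the colourings
satisfying `K` are still possible, and then answers for one of the remaining colourings. -/
noncomputable def queryList (T : SimpleGraph V) : List T.Dart → ((V → Bool) → Prop) →
    QueryAlgorithm T
  | [], K => .halt <| if h : ∃ c o, K c ∧ IsMajorityAnswer c o then h.choose_spec.choose else none
  | d :: l, K => .query d.fst d.snd d.adj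
      (queryList T l fun c => K c ∧ c d.fst = c d.snd)
      (queryList T l fun c => K c ∧ c d.fst ≠ c d.snd)

theorem queryCount_queryList (c : V → Bool) (l : List T.Dart) (K : (V → Bool) → Prop) :
    (queryList T l K).queryCount c = l.length := by
  induction l generalizing K with
  | nil => rfl
  | cons d l ih =>
    rw [queryList, QueryAlgorithm.queryCount, ih, ih, ite_self, List.length_cons]

theorem exists_isMajorityAnswer (c : V → Bool) : ∃ o, IsMajorityAnswer c o := by
  by_cases h : ∃ v, IsMajorityVertex c v
  · exact ⟨some h.choose, h.choose_spec⟩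
  · exact ⟨none, fun v hv => h ⟨v, hv⟩⟩

theorem isMajorityAnswer_congr {c c' : V → Bool} (h : ∀ u v, c u = c v ↔ c' u = c' v)
    (o : Option V) : IsMajorityAnswer c o ↔ IsMajorityAnswer c' o := by
  have key : ∀ v, IsMajorityVertex c v ↔ IsMajorityVertex c' v := by
    intro v
    simp only [IsMajorityVertex, h]
  cases o with
  | none => simp only [IsMajorityAnswer, key]
  | some v => exact key v

theorem isMajorityAnswer_queryList {c : V → Bool} {l : List T.Dart} {K : (V → Bool) → Prop}
    (hc : K c) (h : ∀ c', K c' → (∀ d ∈ l, (c d.fst = c d.snd ↔ c' d.fst = c' d.snd)) →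
      ∀ u v, c u = c v ↔ c' u = c' v) :
    IsMajorityAnswer c ((queryList T l K).output c) := by
  induction l generalizing K with
  | nil =>
    obtain ⟨o, ho⟩ := exists_isMajorityAnswer c
    have hex : ∃ c o, K c ∧ IsMajorityAnswer c o := ⟨c, o, hc, ho⟩
    rw [queryList, QueryAlgorithm.output, dif_pos hex]
    obtain ⟨h1, h2⟩ := hex.choose_spec.choose_spec
    exact (isMajorityAnswer_congr (h _ h1 (by simp)) _).2 h2
  | cons d l ih =>
    rw [queryList, QueryAlgorithm.output]
    split_ifs with hd
    · refine ih ⟨hc, hd⟩ fun c' hK hl => h c' hK.1 fun e he => ?_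
      rcases List.mem_cons.1 he with rfl | he
      · simp [hd, hK.2]
      · exact hl e he
    · refine ih ⟨hc, hd⟩ fun c' hK hl => h c' hK.1 fun e he => ?_
      rcases List.mem_cons.1 he with rfl | he
      · simp [hd, hK.2]
      · exact hl e he

theorem SimpleGraph.Connected.eq_iff_of_forall_adj (hT : T.Connected) {c c' : V → Bool}
    (h : ∀ u v, T.Adj u v → (c u = c v ↔ c' u = c' v)) (u v : V) : c u = c v ↔ c' u = c' v := by
  obtain ⟨w⟩ := hT.preconnected u v
  induction w with
  | nil => simp
  | @cons u v w huv p ih =>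
    have := h u v huv
    revert this ih
    cases c u <;> cases c v <;> cases c w <;> cases c' u <;> cases c' v <;> cases c' w <;> simp

theorem SimpleGraph.IsTree.majorityNumber_le (hT : T.IsTree) :
    majorityNumber T ≤ ((Fintype.card V - 1 : ℕ) : ℕ∞) := by
  classical
  have hdart : ∀ e ∈ T.edgeFinset, ∃ d : T.Dart, d.edge = e := by
    intro e he
    induction e using Sym2.ind with
    | _ u v => exact ⟨⟨(u, v), by simpa using he⟩, rfl⟩
  choose f hf using hdart
  refine iInf₂_le_of_le (queryList T (T.edgeFinset.attach.toList.map
    fun e : {e // e ∈ T.edgeFinset} => f e.1 e.2) fun _ => True) ?_ ?_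
  · intro c
    refine isMajorityAnswer_queryList trivial fun c' _ h => ?_
    refine hT.connected.eq_iff_of_forall_adj fun u v huv => ?_
    have he : s(u, v) ∈ T.edgeFinset := by simpa using huv
    have h1 := h (f s(u, v) he) (List.mem_map.2
      ⟨⟨s(u, v), he⟩, Finset.mem_toList.2 (Finset.mem_attach _ _), rfl⟩)
    rcases SimpleGraph.dart_edge_eq_mk'_iff'.1 (hf _ he) with ⟨h2, h3⟩ | ⟨h2, h3⟩
    · rwa [h2, h3] at h1
    · rw [h2, h3] at h1
      rwa [eq_comm, @eq_comm _ (c' u)]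
  · refine iSup_le fun c => ?_
    rw [queryCount_queryList, List.length_map, Finset.length_toList, Finset.card_attach]
    have := hT.card_edgeFinset
    exact_mod_cast (by omega : T.edgeFinset.card ≤ Fintype.card V - 1)

end UpperBound

/-! ### Cutting a tree into small pieces -/

section Anchors

variable {V : Type*} [DecidableEq V]

/-- In a rooted tree, the child of `v` on the way from `x` to `v` is unique. -/
theorem iterate_eq_unique {p : V → V} {d : V → ℕ} {r : V} (hr : p r = r)
    (hd : ∀ x, x ≠ r → d (p x) < d x) {v w w' x : V} {i j : ℕ} (hw : p w = v) (hwv : w ≠ v)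
    (hi : p^[i] x = w) (hw' : p w' = v) (hwv' : w' ≠ v) (hj : p^[j] x = w') : w = w' := by
  have hle : ∀ (m : ℕ) (y : V), d (p^[m] y) ≤ d y := by
    intro m y
    induction m with
    | zero => exact le_rfl
    | succ m ih =>
      rw [Function.iterate_succ_apply']
      by_cases h : p^[m] y = r
      · rw [h, hr, ← h]
        exact ih
      · exact (hd _ h).le.trans ih
  have key : ∀ {w w' : V} {i j : ℕ}, p w = v → p^[i] x = w → p w' = v → w' ≠ v →
      p^[j] x = w' → ¬ i < j := by
    intro w w' i j hw hi hw' hwv' hj hij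
    obtain ⟨m, rfl⟩ := Nat.exists_eq_add_of_lt hij
    have h1 : p^[m] v = w' := by
      rw [← hj, show i + m + 1 = (m + 1) + i by ring, Function.iterate_add_apply, hi,
        Function.iterate_succ_apply, hw]
    have h2 := hle m v
    have h3 : w' ≠ r := fun h => hwv' (by rw [← hw', h, hr])
    have h4 := hd w' h3
    rw [hw'] at h4
    rw [h1] at h2
    omega
  have h1 := key hw hi hw' hwv' hj
  have h2 := key hw' hj hw hwv hi
  have h3 : i = j := by omega
  rw [← hi, ← hj, h3]

/-- A rooted tree, given by its parent function `p`, has a set `B` of at most `n / k` vertices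
whose removal leaves pieces of fewer than `k` vertices. A deepest vertex that still has at least
`k` descendants (itself included) goes into `B`, and its descendants are removed. -/
theorem exists_separator_of_parent {p : V → V} {d : V → ℕ} {r : V} (hr : p r = r)
    (hd : ∀ x, x ≠ r → d (p x) < d x) {k : ℕ} (hk : 0 < k) (U : Finset V)
    (hU : ∀ x ∈ U, p x ∈ U) :
    ∃ B ⊆ U, ∃ lab : V → V, k * B.card ≤ U.card ∧ (∀ x ∈ U, x ∉ B → lab x ∈ U) ∧
      (∀ x ∈ U, x ∉ B → p x ∉ B → lab x = lab (p x)) ∧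
      ∀ g, (U.filter fun x => x ∉ B ∧ lab x = g).card < k := by
  classical
  induction U using Finset.strongInduction with
  | H U ih =>
  have hiter : ∀ (i : ℕ) (x : V), x ∈ U → p^[i] x ∈ U := by
    intro i x hx
    induction i with
    | zero => exact hx
    | succ i ih => rw [Function.iterate_succ_apply']; exact hU _ ih
  have hroot : ∀ x, ∃ i, p^[i] x = r := by
    intro x
    induction hm : d x using Nat.strong_induction_on generalizing x with
    | _ m ih =>
    by_cases hx : x = r
    · exact ⟨0, hx⟩
    · obtain ⟨i, hi⟩ := ih _ (hm ▸ hd x hx) (p x) rfl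
      exact ⟨i + 1, hi⟩
  by_cases hUk : U.card < k
  · refine ⟨∅, Finset.empty_subset U, fun _ => r, by simp, fun x hx _ => ?_, fun _ _ _ _ => rfl,
      fun g => (Finset.card_filter_le _ _).trans_lt hUk⟩
    obtain ⟨i, hi⟩ := hroot x
    exact hi ▸ hiter i x hx
  push Not at hUk
  set desc : V → Finset V := fun v => U.filter fun x => ∃ i, p^[i] x = v with hdesc
  have hmem : ∀ {v x}, x ∈ desc v ↔ x ∈ U ∧ ∃ i, p^[i] x = v := by
    intro v x
    rw [hdesc, Finset.mem_filter]
  have hrU : r ∈ U.filter fun v => k ≤ (desc v).card := by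
    obtain ⟨x, hx⟩ := Finset.card_pos.1 (hk.trans_le hUk)
    obtain ⟨i, hi⟩ := hroot x
    have h1 : desc r = U := Finset.filter_true_of_mem fun x _ => hroot x
    exact Finset.mem_filter.2 ⟨hi ▸ hiter i x hx, by rw [h1]; exact hUk⟩
  obtain ⟨v, hv, hmax⟩ := Finset.exists_max_image _ d ⟨r, hrU⟩
  rw [Finset.mem_filter] at hv
  have hvv : v ∈ desc v := hmem.2 ⟨hv.1, 0, rfl⟩
  have hsub : desc v ⊆ U := Finset.filter_subset _ _
  have hclosed : ∀ x ∈ U \ desc v, p x ∈ U \ desc v := by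
    intro x hx
    rw [Finset.mem_sdiff] at hx ⊢
    refine ⟨hU x hx.1, fun h => hx.2 ?_⟩
    obtain ⟨i, hi⟩ := (hmem.1 h).2
    exact hmem.2 ⟨hx.1, i + 1, hi⟩
  obtain ⟨B, hB, lab, h1, h2, h3, h4⟩ :=
    ih (U \ desc v) (Finset.sdiff_ssubset hsub ⟨v, hvv⟩) hclosed
  have hchild : ∀ x, x ∈ desc v → x ≠ v → ∃ w, p w = v ∧ w ≠ v ∧ ∃ i, p^[i] x = w := by
    intro x hx hxv
    obtain ⟨i, hi⟩ := (hmem.1 hx).2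
    clear hx
    induction i generalizing x with
    | zero => exact absurd hi hxv
    | succ i ih =>
      by_cases hpx : p x = v
      · exact ⟨x, hpx, hxv, 0, rfl⟩
      · obtain ⟨w, hw, hwv, j, hj⟩ := ih (p x) hpx hi
        exact ⟨w, hw, hwv, j + 1, hj⟩
  have : Nonempty V := ⟨r⟩
  choose! w hw hwv hwi using hchild
  have hwU : ∀ x ∈ desc v, x ≠ v → w x ∈ desc v := by
    intro x hx hxv
    obtain ⟨i, hi⟩ := hwi x hx hxv
    exact hmem.2 ⟨hi ▸ hiter i x (hsub hx), 1, hw x hx hxv⟩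
  have hvB : v ∉ B := fun h => (Finset.mem_sdiff.1 (hB h)).2 hvv
  refine ⟨insert v B, Finset.insert_subset hv.1 (hB.trans Finset.sdiff_subset),
    fun x => if x ∈ desc v then w x else lab x, ?_, ?_, ?_, ?_⟩
  · rw [Finset.card_insert_of_notMem hvB, mul_add, mul_one]
    have h5 := Finset.card_sdiff_add_card_eq_card hsub
    omega
  · intro x hx hxB
    rw [Finset.mem_insert, not_or] at hxB
    dsimp only
    split_ifs with hxv
    · exact hsub (hwU x hxv hxB.1)
    · exact Finset.sdiff_subset (h2 x (Finset.mem_sdiff.2 ⟨hx, hxv⟩) hxB.2)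
  · intro x hx hxB hpB
    rw [Finset.mem_insert, not_or] at hxB hpB
    dsimp only
    by_cases hxv : x ∈ desc v
    · have hpv : p x ∈ desc v := by
        obtain ⟨i, hi⟩ := (hmem.1 hxv).2
        cases i with
        | zero => exact absurd hi hxB.1
        | succ i => exact hmem.2 ⟨hU x hx, i, hi⟩
      rw [if_pos hxv, if_pos hpv]
      obtain ⟨i, hi⟩ := hwi x hxv hxB.1
      obtain ⟨j, hj⟩ := hwi (p x) hpv hpB.1
      exact iterate_eq_unique hr hd (j := j + 1) (hw x hxv hxB.1) (hwv x hxv hxB.1) hi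
        (hw _ hpv hpB.1) (hwv _ hpv hpB.1) hj
    · have hx' := Finset.mem_sdiff.2 ⟨hx, hxv⟩
      rw [if_neg hxv, if_neg (Finset.mem_sdiff.1 (hclosed x hx')).2]
      exact h3 x hx' hxB.2 hpB.2
  · intro g
    by_cases hg : g ∈ desc v
    · have key : ∀ x, x ∈ U → x ∉ insert v B → (if x ∈ desc v then w x else lab x) = g →
          x ∈ desc v ∧ x ≠ v ∧ w x = g := by
        intro x hx hxB hxg
        rw [Finset.mem_insert, not_or] at hxB
        split_ifs at hxg with hxv
        · exact ⟨hxv, hxB.1, hxg⟩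
        · exact absurd hg (hxg ▸ (Finset.mem_sdiff.1
            (h2 x (Finset.mem_sdiff.2 ⟨hx, hxv⟩) hxB.2)).2)
      by_contra! hcon
      have hdg : (desc g).card < k := by
        obtain ⟨x, hx⟩ := Finset.card_pos.1 (hk.trans_le hcon)
        rw [Finset.mem_filter] at hx
        obtain ⟨hxv, hne, hxg⟩ := key x hx.1 hx.2.1 hx.2.2
        by_contra! hkg
        have hle := hmax g (Finset.mem_filter.2 ⟨hsub hg, hkg⟩)
        have hgr : g ≠ r := by
          intro h
          apply hwv x hxv hne
          rw [← hw x hxv hne, hxg, h, hr]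
        have hlt := hd g hgr
        rw [← hxg, hw x hxv hne, hxg] at hlt
        omega
      refine absurd hcon (not_le.2 (lt_of_le_of_lt (Finset.card_le_card fun x hx => ?_) hdg))
      rw [Finset.mem_filter] at hx
      obtain ⟨hxv, hne, hxg⟩ := key x hx.1 hx.2.1 hx.2.2
      exact hmem.2 ⟨hx.1, hxg ▸ hwi x hxv hne⟩
    · refine lt_of_le_of_lt (Finset.card_le_card fun x hx => ?_) (h4 g)
      rw [Finset.mem_filter, Finset.mem_insert, not_or] at hx
      obtain ⟨hxU, ⟨hne, hxB⟩, hxg⟩ := hx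
      dsimp only at hxg
      split_ifs at hxg with hxv
      · exact absurd (hxg ▸ hwU x hxv hne) hg
      · exact Finset.mem_filter.2 ⟨Finset.mem_sdiff.2 ⟨hxU, hxv⟩, hxB, hxg⟩

/-- Every tree has a parent function: the edges that lead towards the root are all distinct,
and there are as many of them as there are edges. -/
theorem SimpleGraph.IsTree.exists_parent [Fintype V] {T : SimpleGraph V} (hT : T.IsTree) :
    ∃ (r : V) (p : V → V) (d : V → ℕ), p r = r ∧ (∀ x, x ≠ r → d (p x) < d x) ∧
      ∀ x y, T.Adj x y → p x = y ∨ p y = x := by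
  classical
  obtain ⟨r⟩ := hT.connected.nonempty
  have hpar : ∀ x, x ≠ r → ∃ y, T.Adj x y ∧ T.dist r y < T.dist r x := by
    intro x hx
    obtain ⟨w, hw⟩ := hT.connected.exists_walk_length_eq_dist x r
    cases w with
    | nil => exact absurd rfl hx
    | @cons _ y _ h q =>
      refine ⟨y, h, ?_⟩
      rw [SimpleGraph.Walk.length_cons] at hw
      have := SimpleGraph.dist_le q
      rw [T.dist_comm (u := r) (v := y), T.dist_comm (u := r) (v := x)]
      omega
  have : Nonempty V := ⟨r⟩
  choose! p hp hlt using hpar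
  refine ⟨r, fun x => if x = r then r else p x, T.dist r, by simp,
    fun x hx => by simpa [hx] using hlt x hx, ?_⟩
  have hinj : Set.InjOn (fun x => s(x, p x)) (Finset.univ.erase r : Finset V) := by
    intro x hx y hy hxy
    have hx' : x ≠ r := by simpa using hx
    have hy' : y ≠ r := by simpa using hy
    rcases Sym2.eq_iff.1 hxy with ⟨h, -⟩ | ⟨h1, h2⟩
    · exact h
    · have h3 := hlt x hx'
      have h4 := hlt y hy'
      rw [h2] at h3
      rw [← h1] at h4
      omega
  have himage : (Finset.univ.erase r).image (fun x => s(x, p x)) = T.edgeFinset := by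
    refine Finset.eq_of_subset_of_card_le ?_ ?_
    · intro e he
      obtain ⟨x, hx, rfl⟩ := Finset.mem_image.1 he
      simpa using hp x (by simpa using hx)
    · rw [Finset.card_image_of_injOn hinj, Finset.card_erase_of_mem (Finset.mem_univ r),
        Finset.card_univ, ← hT.card_edgeFinset]
      simp
  intro x y hxy
  have he : s(x, y) ∈ T.edgeFinset := by simpa using hxy
  rw [← himage] at he
  obtain ⟨z, hz, hzxy⟩ := Finset.mem_image.1 he
  have hz' : z ≠ r := by simpa using hz
  rcases Sym2.eq_iff.1 hzxy with ⟨rfl, h⟩ | ⟨rfl, h⟩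
  · exact Or.inl (by simpa [hz'] using h)
  · exact Or.inr (by simpa [hz'] using h)

theorem SimpleGraph.IsTree.exists_separator [Fintype V] {T : SimpleGraph V} (hT : T.IsTree)
    {k : ℕ} (hk : 0 < k) :
    ∃ (B : Finset V) (lab : V → V), k * B.card ≤ Fintype.card V ∧
      (∀ x ∉ B, ∀ y ∉ B, T.Adj x y → lab x = lab y) ∧
      ∀ g, (Finset.univ.filter fun x => x ∉ B ∧ lab x = g).card < k := by
  obtain ⟨r, p, d, hr, hd, hp⟩ := hT.exists_parent
  obtain ⟨B, -, lab, h1, -, h2, h3⟩ :=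
    exists_separator_of_parent hr hd hk Finset.univ fun _ _ => Finset.mem_univ _
  refine ⟨B, lab, h1, fun x hx y hy hxy => ?_, h3⟩
  rcases hp x y hxy with h | h
  · rw [h2 x (Finset.mem_univ x) hx (h ▸ hy), h]
  · rw [h2 y (Finset.mem_univ y) hy (h ▸ hx), h]

end Anchors

/-! ### Laurent polynomials modulo two -/

section Laurent

open LaurentPolynomial

/-- The Laurent polynomial `T ^ a + T ^ (-a)` with coefficients modulo two: the generating
function of the two signs of a block of weight `a`. -/
noncomputable def signPoly (a : ℤ) : LaurentPolynomial (ZMod 2) := T a + T (-a)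

/-- The additive functional that sends `T ^ j` to `w j`. -/
noncomputable def evalWeight (w : ℤ → ZMod 2) : LaurentPolynomial (ZMod 2) →+ ZMod 2 :=
  (Finsupp.liftAddHom fun j => AddMonoidHom.mulRight (w j)).comp
    (AddMonoidAlgebra.coeffAddEquiv : LaurentPolynomial (ZMod 2) ≃+ _).toAddMonoidHom

theorem evalWeight_C_mul_T (w : ℤ → ZMod 2) (a : ZMod 2) (j : ℤ) :
    evalWeight w (C a * T j) = a * w j := by
  rw [← single_eq_C_mul_T]
  exact Finsupp.sum_single_index (by simp)

theorem evalWeight_one (w : ℤ → ZMod 2) : evalWeight w 1 = w 0 := by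
  have := evalWeight_C_mul_T w 1 0
  simpa using this

theorem evalWeight_add_left (w w' : ℤ → ZMod 2) (f : LaurentPolynomial (ZMod 2)) :
    evalWeight (fun j => w j + w' j) f = evalWeight w f + evalWeight w' f := by
  induction f using LaurentPolynomial.induction_on' with
  | add f g hf hg => rw [map_add, map_add, map_add, hf, hg]; ring
  | C_mul_T n a => simp only [evalWeight_C_mul_T]; ring

theorem evalWeight_zero_left (f : LaurentPolynomial (ZMod 2)) :
    evalWeight (fun _ => 0) f = 0 := by
  induction f using LaurentPolynomial.induction_on' with
  | add f g hf hg => rw [map_add, hf, hg, add_zero]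
  | C_mul_T n a => simp only [evalWeight_C_mul_T, mul_zero]

theorem evalWeight_signPoly_mul (w : ℤ → ZMod 2) (a : ℤ) (f : LaurentPolynomial (ZMod 2)) :
    evalWeight w (signPoly a * f) = evalWeight (fun j => w (j + a) + w (j - a)) f := by
  induction f using LaurentPolynomial.induction_on' with
  | add f g hf hg => rw [mul_add, map_add, map_add, hf, hg]
  | C_mul_T n b =>
    have : signPoly a * (C b * T n) = C b * T (n + a) + C b * T (n - a) := by
      rw [signPoly, sub_eq_add_neg, T_add, T_add]
      ring
    rw [this, map_add]
    simp only [evalWeight_C_mul_T]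
    ring

theorem signPoly_zero : signPoly 0 = 0 := by
  rw [signPoly, neg_zero, ← two_smul (ZMod 2), show (2 : ZMod 2) = 0 from rfl, zero_smul]

theorem signPoly_neg (a : ℤ) : signPoly (-a) = signPoly a := by
  rw [signPoly, signPoly, neg_neg, add_comm]

theorem signPoly_natAbs (a : ℤ) : signPoly a.natAbs = signPoly a := by
  rcases Int.natAbs_eq a with h | h
  · rw [← h]
  · rw [h, Int.natAbs_neg, Int.natAbs_natCast, signPoly_neg]

/-- Merging two blocks replaces the product of their factors by the sum of the two outcomes. -/
theorem signPoly_mul (a b : ℤ) :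
    signPoly a * signPoly b = signPoly (a + b) + signPoly (a - b) := by
  simp only [signPoly, sub_eq_add_neg, neg_add, neg_neg, T_add]
  ring

theorem signPoly_sq (a : ℤ) : signPoly a ^ 2 = signPoly (2 * a) := by
  rw [sq, signPoly_mul, sub_self, signPoly_zero, add_zero, two_mul]

theorem signPoly_one_pow_two_pow (m : ℕ) : signPoly 1 ^ 2 ^ m = signPoly (2 ^ m) := by
  induction m with
  | zero => simp
  | succ m ih => rw [pow_succ, pow_mul, ih, signPoly_sq, pow_succ, mul_comm]

theorem signPoly_one_dvd (a : ℤ) : signPoly 1 ∣ signPoly a := by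
  have key : ∀ n : ℕ, signPoly 1 ∣ signPoly n ∧ signPoly 1 ∣ signPoly (n + 1) := by
    intro n
    induction n with
    | zero => simp [signPoly_zero]
    | succ n ih =>
      refine ⟨by simpa using ih.2, ?_⟩
      have h := signPoly_mul (n + 1) 1
      rw [add_sub_cancel_right] at h
      push_cast
      rw [← dvd_add_left ih.1, ← h]
      exact dvd_mul_left _ _
  rw [← signPoly_natAbs a]
  exact (key _).1

/-- The product of the factors `signPoly a` over the members `a` of a multiset. -/
noncomputable def signProd (m : Multiset ℤ) : LaurentPolynomial (ZMod 2) := (m.map signPoly).prod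

/-- The total absolute value of a multiset of integers, which is the degree of `signProd`. -/
def totalWeight (m : Multiset ℤ) : ℕ := (m.map Int.natAbs).sum

theorem signProd_cons (a : ℤ) (m : Multiset ℤ) :
    signProd (a ::ₘ m) = signPoly a * signProd m := by simp [signProd]

theorem totalWeight_cons (a : ℤ) (m : Multiset ℤ) :
    totalWeight (a ::ₘ m) = a.natAbs + totalWeight m := by simp [totalWeight]

theorem evalWeight_signProd_congr {m : Multiset ℤ} {w w' : ℤ → ZMod 2}
    (h : ∀ j : ℤ, j.natAbs ≤ totalWeight m → w j = w' j) :
    evalWeight w (signProd m) = evalWeight w' (signProd m) := by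
  induction m using Multiset.induction_on generalizing w w' with
  | empty =>
    simp only [signProd, Multiset.map_zero, Multiset.prod_zero, evalWeight_one]
    exact h 0 (by simp)
  | cons a m ih =>
    rw [signProd_cons, evalWeight_signPoly_mul, evalWeight_signPoly_mul]
    rw [totalWeight_cons] at h
    exact ih fun j hj => by rw [h _ (by omega), h _ (by omega)]

/-- The leading coefficient of `signProd m` is one. -/
theorem evalWeight_signProd_eq_top {m : Multiset ℤ} {w : ℤ → ZMod 2} (hm : ∀ a ∈ m, a ≠ 0)
    (h : ∀ j : ℤ, j.natAbs ≤ totalWeight m → j ≠ totalWeight m → w j = 0) :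
    evalWeight w (signProd m) = w (totalWeight m) := by
  induction m using Multiset.induction_on generalizing w with
  | empty =>
    simp [signProd, evalWeight_one, totalWeight]
  | cons a m ih =>
    have ha : a ≠ 0 := hm a (Multiset.mem_cons_self a m)
    rw [totalWeight_cons] at h ⊢
    rw [signProd_cons, evalWeight_signPoly_mul,
      ih fun b hb => hm b (Multiset.mem_cons_of_mem hb)]
    · rcases lt_or_gt_of_ne ha with ha | ha
      · rw [h _ (by omega) (by omega), zero_add]
        congr 1
        omega
      · rw [h ((totalWeight m : ℤ) - a) (by omega) (by omega), add_zero]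
        congr 1
        omega
    · intro j hj hj'
      rw [h _ (by omega) (by omega), h _ (by omega) (by omega), add_zero]

/-- A product of at least four factors vanishes modulo `T ^ 8 - 1`, since every factor is
divisible by `signPoly 1` and `signPoly 1 ^ 4 = T ^ 4 + T ^ (-4)`. -/
theorem evalWeight_signProd_of_periodic {m : Multiset ℤ} (hm : 4 ≤ m.card) {w : ℤ → ZMod 2}
    (hw : ∀ j, w (j + 8) = w j) : evalWeight w (signProd m) = 0 := by
  have h1 : ∀ m : Multiset ℤ, signPoly 1 ^ m.card ∣ signProd m := by
    intro m
    induction m using Multiset.induction_on with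
    | empty => simp
    | cons a m ih =>
      rw [signProd_cons, Multiset.card_cons, pow_succ']
      exact mul_dvd_mul (signPoly_one_dvd a) ih
  obtain ⟨g, hg⟩ := (pow_dvd_pow _ hm).trans (h1 m)
  have h4 : signPoly 1 ^ 4 = signPoly 4 := by simpa using signPoly_one_pow_two_pow 2
  rw [hg, h4, evalWeight_signPoly_mul, ← evalWeight_zero_left g]
  congr 2
  funext j
  have : w (j + 4) = w (j - 4) := by rw [← hw (j - 4)]; congr 1; ring
  rw [this]
  exact CharTwo.add_self_eq_zero _

/-- The indicator of the positive integers congruent to `r` modulo eight. -/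
def posClass (r j : ℤ) : ZMod 2 := if 0 < j ∧ j % 8 = r then 1 else 0

/-- If one weight exceeds the sum of at least four others, then the terms of positive degree of
the product vanish modulo `T ^ 8 - 1`. -/
theorem evalWeight_posClass_of_dominated {m : Multiset ℤ} {d : ℤ} (hd : totalWeight m < d.natAbs)
    (hm : 4 ≤ m.card) (r : ℤ) : evalWeight (posClass r) (signPoly d * signProd m) = 0 := by
  rw [← signPoly_natAbs d, evalWeight_signPoly_mul,
    evalWeight_signProd_congr (w' := fun j => if (j + d.natAbs) % 8 = r then 1 else 0)]
  · refine evalWeight_signProd_of_periodic hm fun j => ?_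
    have : (j + 8 + d.natAbs) % 8 = (j + d.natAbs) % 8 := by omega
    rw [this]
  · intro j hj
    have h1 : 0 < j + d.natAbs := by omega
    have h2 : ¬ 0 < j - d.natAbs := by omega
    simp only [posClass, h1, h2, true_and, false_and, if_false, add_zero]

/-- If the total weight exceeds twice a multiple `h` of eight by one or three, then the terms of
positive degree of the product do not vanish modulo `T ^ 8 - 1`. -/
theorem evalWeight_posClass_signPoly_mul {m : Multiset ℤ} {h δ : ℕ} (h8 : 8 ∣ h)
    (hδ : δ = 1 ∨ δ = 3) (hm0 : ∀ a ∈ m, a ≠ 0) (hm : 4 ≤ m.card) (hw : totalWeight m = h + δ) :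
    evalWeight (posClass δ) (signPoly h * signProd m) = 1 := by
  have hper : evalWeight (fun j => if j % 8 = δ then 1 else 0) (signProd m) = 0 :=
    evalWeight_signProd_of_periodic hm fun j => by simp
  -- Modulo `T ^ 8 - 1` the product `signProd m` vanishes and `T ^ h` is `1`. So the residue
  -- class functional may be added, which cancels the terms of `signProd m` of degree in `(-h, h]`.
  -- Of the others, only the leading one lies in the residue class of `δ`.
  rw [evalWeight_signPoly_mul, ← add_zero (evalWeight _ _), ← hper, ← evalWeight_add_left,
    evalWeight_signProd_eq_top hm0, hw]
  · have h1 : 0 < ((h + δ : ℕ) : ℤ) + h ∧ (((h + δ : ℕ) : ℤ) + h) % 8 = δ := by omega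
    have h2 : 0 < ((h + δ : ℕ) : ℤ) - h ∧ (((h + δ : ℕ) : ℤ) - h) % 8 = δ := by omega
    have h3 : ((h + δ : ℕ) : ℤ) % 8 = δ := by omega
    simp only [posClass, if_pos h1, if_pos h2, if_pos h3]
    decide
  · intro j hj hj'
    rw [hw] at hj hj'
    by_cases h3 : j % 8 = δ
    · have h1 : 0 < j + h ∧ (j + h) % 8 = δ := by omega
      have h2 : ¬ (0 < j - h ∧ (j - h) % 8 = δ) := by omega
      simp only [posClass, if_pos h1, if_neg h2, if_pos h3]
      decide
    · have h1 : ¬ (0 < j + h ∧ (j + h) % 8 = δ) := by omega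
      have h2 : ¬ (0 < j - h ∧ (j - h) % 8 = δ) := by omega
      simp only [posClass, if_neg h1, if_neg h2, if_neg h3, add_zero]

end Laurent

/-! ### Odd order: counting blocks of charge zero -/

section ZeroBlocks

variable {V : Type*} [Fintype V] [DecidableEq V] {T : SimpleGraph V} [DecidableRel T.Adj]
  {P : Finset (Finset V)}

theorem IsBlockPartition.sum_card_inter (hP : IsBlockPartition T P) (B : Finset V) :
    ∑ X ∈ P, (X ∩ B).card = B.card := by
  have h := hP.sum_blocks fun x => if x ∈ B then 1 else 0
  simp only [← Finset.card_filter, Finset.filter_mem_eq_inter] at h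
  simpa using h

theorem IsBlockPartition.pairwiseDisjoint_subset (hP : IsBlockPartition T P)
    {Q : Finset (Finset V)} (hQ : Q ⊆ P) : (Q : Set (Finset V)).PairwiseDisjoint id :=
  fun X hX Y hY h => hP.disjoint X (hQ hX) Y (hQ hY) h

/-- If the vertices of `W` are labelled such that adjacent ones have equal labels, then the
forest on `W` has at least as many components as there are labels. -/
theorem SimpleGraph.IsTree.innerDegree_add_card_image_le (hT : T.IsTree) {W : Finset V}
    {lab : V → V} (hlab : ∀ x ∈ W, ∀ y ∈ W, T.Adj x y → lab x = lab y) :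
    innerDegree T W + 2 * (W.image lab).card ≤ 2 * W.card := by
  have h1 : innerDegree T W = ∑ g ∈ W.image lab, innerDegree T (W.filter fun x => lab x = g) := by
    unfold innerDegree
    rw [← Finset.sum_fiberwise_of_maps_to fun x hx => Finset.mem_image_of_mem lab hx]
    refine Finset.sum_congr rfl fun g _ => Finset.sum_congr rfl fun x hx => ?_
    congr 1
    ext y
    rw [Finset.mem_filter] at hx
    simp only [Finset.mem_inter, Finset.mem_filter, SimpleGraph.mem_neighborFinset]
    exact ⟨fun h => ⟨h.1, h.2, by rw [← hlab x hx.1 y h.2 h.1, hx.2]⟩, fun h => ⟨h.1, h.2.1⟩⟩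
  have h2 : W.card = ∑ g ∈ W.image lab, (W.filter fun x => lab x = g).card :=
    Finset.card_eq_sum_card_image lab W
  rw [h1, h2, Finset.mul_sum, mul_comm, ← smul_eq_mul, ← Finset.sum_const,
    ← Finset.sum_add_distrib]
  refine Finset.sum_le_sum fun g hg => ?_
  obtain ⟨x, hx, hxg⟩ := Finset.mem_image.1 hg
  exact hT.innerDegree_add_two_le ⟨x, Finset.mem_filter.2 ⟨hx, hxg⟩⟩

/-- Let `Z` be a set of blocks of even degree sum that avoid `B`, where the removal of `B` cuts
the tree into pieces of at most `k` vertices. If `Q` is the set of the other blocks, then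
`Z` meets fewer than `Q.card` pieces. Indeed the union `W` of `Z` has degree sum at least
`2 * W.card`, and it spans at most `W.card` minus the number of pieces edges, while the
rest spans at least its order minus `Q.card`; all edges of the tree number one less than its
order. -/
theorem IsBlockPartition.card_filter_le (hP : IsBlockPartition T P) (hT : T.IsTree)
    (h1 : 1 < P.card) {B : Finset V} {lab : V → V} {k : ℕ}
    (hlab : ∀ x ∉ B, ∀ y ∉ B, T.Adj x y → lab x = lab y)
    (hk : ∀ g, (Finset.univ.filter fun x => x ∉ B ∧ lab x = g).card ≤ k)
    {p : Finset V → Prop} [DecidablePred p]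
    (hp : ∀ C ∈ P, p C → (C ∩ B).card = 0 ∧ Even (degreeSum T C)) :
    (P.filter p).card + k ≤ k * (P.filter fun C => ¬ p C).card := by
  set Z := P.filter p with hZ
  set Q := P.filter fun C => ¬ p C with hQ
  have hZP : Z ⊆ P := Finset.filter_subset _ _
  have hQP : Q ⊆ P := Finset.filter_subset _ _
  have hdZ := hP.pairwiseDisjoint_subset hZP
  have hdQ := hP.pairwiseDisjoint_subset hQP
  set W := Z.biUnion id with hW
  set Y := Q.biUnion id with hY
  have hWB : ∀ x ∈ W, x ∉ B := by
    intro x hx hxB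
    obtain ⟨C, hC, hxC⟩ := Finset.mem_biUnion.1 hx
    have h0 := (hp C (hZP hC) (Finset.mem_filter.1 hC).2).1
    rw [Finset.card_eq_zero] at h0
    exact Finset.notMem_empty x (h0 ▸ Finset.mem_inter.2 ⟨hxC, hxB⟩)
  have hWY : Disjoint W Y := by
    rw [hW, hY, Finset.disjoint_biUnion_left]
    intro C hC
    rw [Finset.disjoint_biUnion_right]
    intro D hD
    refine hP.disjoint C (hZP hC) D (hQP hD) ?_
    rintro rfl
    exact (Finset.mem_filter.1 hD).2 (Finset.mem_filter.1 hC).2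
  have huniv : W ∪ Y = Finset.univ := by
    refine Finset.eq_univ_iff_forall.2 fun v => ?_
    obtain ⟨C, hC, hv⟩ := hP.cover v
    by_cases hpC : p C
    · exact Finset.mem_union_left _ (Finset.mem_biUnion.2 ⟨C, Finset.mem_filter.2 ⟨hC, hpC⟩, hv⟩)
    · exact Finset.mem_union_right _ (Finset.mem_biUnion.2 ⟨C, Finset.mem_filter.2 ⟨hC, hpC⟩, hv⟩)
  have hcW : W.card = ∑ C ∈ Z, C.card := Finset.card_biUnion hdZ
  have hcY : Y.card = ∑ C ∈ Q, C.card := Finset.card_biUnion hdQ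
  have hdegW : 2 * W.card ≤ degreeSum T W := by
    have : degreeSum T W = ∑ C ∈ Z, degreeSum T C := Finset.sum_biUnion hdZ
    rw [this, hcW, Finset.mul_sum]
    refine Finset.sum_le_sum fun C hC => ?_
    have h2 := hP.two_mul_card_le hT.connected h1 (hZP hC)
    obtain ⟨r, hr⟩ := (hp C (hZP hC) (Finset.mem_filter.1 hC).2).2
    omega
  have hinY : 2 * Y.card ≤ innerDegree T Y + 2 * Q.card := by
    have h2 : ∑ C ∈ Q, innerDegree T C ≤ innerDegree T Y := by
      rw [innerDegree, hY, Finset.sum_biUnion hdQ]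
      refine Finset.sum_le_sum fun C hC => Finset.sum_le_sum fun x _ => ?_
      exact Finset.card_le_card (Finset.inter_subset_inter_left
        (Finset.subset_biUnion_of_mem id hC))
    have h3 : ∑ C ∈ Q, 2 * C.card ≤ ∑ C ∈ Q, (innerDegree T C + 2) :=
      Finset.sum_le_sum fun C hC => hP.inner C (hQP hC)
    rw [Finset.sum_add_distrib, Finset.sum_const, smul_eq_mul, ← Finset.mul_sum, ← hcY] at h3
    omega
  have hinW : innerDegree T W + 2 * (W.image lab).card ≤ 2 * W.card :=
    hT.innerDegree_add_card_image_le fun x hx y hy => hlab x (hWB x hx) y (hWB y hy)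
  have hYW : Y = Wᶜ := by
    rw [eq_compl_iff_isCompl, isCompl_iff, codisjoint_iff]
    exact ⟨hWY.symm, by rw [Finset.sup_eq_union, Finset.union_comm, huniv]; rfl⟩
  have hsplit := degreeSum_eq_innerDegree_add (T := T) W
  have htotal := innerDegree_union (T := T) hWY
  rw [huniv, innerDegree_univ, sum_card_neighborFinset_inter_comm Y W, hYW] at htotal
  rw [hYW] at hinY
  have htree := hT.degreeSum_univ
  have hcard : W.card + Wᶜ.card = Fintype.card V := Finset.card_add_card_compl W
  have hlabels : (W.image lab).card + 1 ≤ Q.card := by omega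
  have hZW : Z.card ≤ W.card := by
    rw [hcW, Finset.card_eq_sum_ones]
    exact Finset.sum_le_sum fun C hC => Finset.card_pos.2 (hP.nonempty C (hZP hC))
  have hWk : W.card ≤ k * (W.image lab).card := by
    refine Finset.card_le_mul_card_image W k fun g _ => le_trans (Finset.card_le_card ?_) (hk g)
    intro x hx
    rw [Finset.mem_filter] at hx
    exact Finset.mem_filter.2 ⟨Finset.mem_univ x, hWB x hx.1, hx.2⟩
  calc Z.card + k ≤ k * ((W.image lab).card + 1) := by
        rw [mul_add, mul_one]
        omega
    _ ≤ k * Q.card := Nat.mul_le_mul_left k hlabels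

end ZeroBlocks

/-! ### Odd order: the strategy of the adversary -/

section OddOrder

variable {V : Type*} [Fintype V] [DecidableEq V] {T : SimpleGraph V} [DecidableRel T.Adj]
  {P : Finset (Finset V)} {B : Finset V} {c : V → Bool}

/-- The positions of the first phase: blocks that avoid the separator `B` have their static
weight, while blocks that meet `B` have a positive weight bounded in terms of their share
of `B`. -/
def IsAnchored (T : SimpleGraph V) [DecidableRel T.Adj] (B : Finset V) (P : Finset (Finset V))
    (c : V → Bool) : Prop :=
  ∀ C ∈ P, ((C ∩ B).card = 0 → (charge c C).natAbs = staticWeight T C) ∧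
    ((C ∩ B).card ≠ 0 → 1 ≤ (charge c C).natAbs ∧ (charge c C).natAbs ≤ 4 * (C ∩ B).card)

/-- The total weight of a position. -/
def positionWeight (P : Finset (Finset V)) (c : V → Bool) : ℕ := ∑ C ∈ P, (charge c C).natAbs

/-- The factor of a block in the generating function; blocks of charge zero do not count. -/
noncomputable def blockPoly (c : V → Bool) (C : Finset V) : LaurentPolynomial (ZMod 2) :=
  if charge c C = 0 then 1 else signPoly (charge c C)

/-- The positions of the second phase: the terms of positive degree of the product of the
`T ^ a + T ^ (-a)` over the nonzero charges `a` do not vanish modulo `T ^ 8 - 1`. Blocks of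
charge zero avoid the separator and have even degree sum. -/
def IsSignBalanced (T : SimpleGraph V) [DecidableRel T.Adj] (B : Finset V) (P : Finset (Finset V))
    (c : V → Bool) : Prop :=
  (∀ C ∈ P, charge c C = 0 → (C ∩ B).card = 0 ∧ Even (degreeSum T C)) ∧
    ∃ r, evalWeight (posClass r) (∏ C ∈ P, blockPoly c C) ≠ 0

/-- A possible merge in the first phase costs at most four units of weight. -/
theorem IsAnchored.exists_mergeBlocks (hP : IsBlockPartition T P) (hc : IsAnchored T B P c)
    {X Y : Finset V} (hX : X ∈ P) (hY : Y ∈ P) (hXY : X ≠ Y) :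
    ∃ c', AgreeOn P c c' ∧ IsAnchored T B (mergeBlocks P X Y) c' ∧
      positionWeight P c ≤ positionWeight (mergeBlocks P X Y) c' + 4 := by
  have hd := hP.disjoint X hX Y hY hXY
  have hcard : ((X ∪ Y) ∩ B).card = (X ∩ B).card + (Y ∩ B).card := by
    rw [Finset.union_inter_distrib_right, Finset.card_union_of_disjoint]
    exact hd.mono Finset.inter_subset_left Finset.inter_subset_left
  obtain ⟨hX0, hX1⟩ := hc X hX
  obtain ⟨hY0, hY1⟩ := hc Y hY
  have hXs := staticWeight_le_two (T := T) X
  have hYs := staticWeight_le_two (T := T) Y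
  let good : ℤ → Prop := fun z =>
    (((X ∪ Y) ∩ B).card = 0 → z.natAbs = staticWeight T (X ∪ Y)) ∧
    (((X ∪ Y) ∩ B).card ≠ 0 → 1 ≤ z.natAbs ∧ z.natAbs ≤ 4 * ((X ∪ Y) ∩ B).card) ∧
    (charge c X).natAbs + (charge c Y).natAbs ≤ z.natAbs + 4
  have hgood : good (charge c X + charge c Y) ∨ good (charge c X - charge c Y) := by
    simp only [good, hcard]
    generalize charge c X = a at *
    generalize charge c Y = b at *
    by_cases hα : (X ∩ B).card = 0 <;> by_cases hβ : (Y ∩ B).card = 0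
    · have ha := hX0 hα
      have hb := hY0 hβ
      rcases staticWeight_union hd ha hb with h | h
      · left; omega
      · right; omega
    · have ha := hX0 hα
      have hb := hY1 hβ
      omega
    · have ha := hX1 hα
      have hb := hY0 hβ
      omega
    · have ha := hX1 hα
      have hb := hY1 hβ
      omega
  have hsign : ∃ s : Bool, good (if s then charge c X + charge c Y else charge c X - charge c Y) :=
    hgood.elim (fun h => ⟨true, by simpa using h⟩) fun h => ⟨false, by simpa using h⟩
  obtain ⟨s, hs⟩ := hsign
  obtain ⟨c', h1, h2, h3⟩ := hP.exists_agreeOn_charge hX hY hXY c s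
  rw [← h2] at hs
  refine ⟨c', h1, fun C hC => ?_, ?_⟩
  · rcases Finset.mem_insert.1 hC with rfl | hC
    · exact ⟨hs.1, hs.2.1⟩
    · rw [h3 C hC]
      exact hc C (Finset.mem_of_mem_erase (Finset.mem_of_mem_erase hC))
  · rw [positionWeight, positionWeight, hP.sum_mergeBlocks hX, sum_eq_add_add hX hY hXY,
      Finset.sum_congr rfl fun C hC => congrArg Int.natAbs (h3 C hC)]
    have := hs.2.2
    omega

theorem IsSignBalanced.exists_mergeBlocks (hP : IsBlockPartition T P) (hc : IsSignBalanced T B P c)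
    {X Y : Finset V} (hX : X ∈ P) (hY : Y ∈ P) (hXY : X ≠ Y) :
    ∃ c', AgreeOn P c c' ∧ IsSignBalanced T B (mergeBlocks P X Y) c' := by
  obtain ⟨hc0, r, hr⟩ := hc
  have hd := hP.disjoint X hX Y hY hXY
  rw [prod_eq_mul_mul hX hY hXY] at hr
  have hrest : ∀ c', (∀ Z ∈ (P.erase X).erase Y, charge c' Z = charge c Z) →
      ∏ Z ∈ mergeBlocks P X Y, blockPoly c' Z
        = blockPoly c' (X ∪ Y) * ∏ Z ∈ (P.erase X).erase Y, blockPoly c Z := by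
    intro c' h
    rw [hP.prod_mergeBlocks hX]
    congr 1
    exact Finset.prod_congr rfl fun Z hZ => by rw [blockPoly, blockPoly, h Z hZ]
  have hzero : ∀ c', (∀ Z ∈ (P.erase X).erase Y, charge c' Z = charge c Z) →
      (charge c' (X ∪ Y) = 0 → charge c X = 0 ∧ charge c Y = 0) →
      ∀ C ∈ mergeBlocks P X Y, charge c' C = 0 → (C ∩ B).card = 0 ∧ Even (degreeSum T C) := by
    intro c' h h' C hC hC0
    rcases Finset.mem_insert.1 hC with rfl | hC
    · obtain ⟨hX0, hY0⟩ := h' hC0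
      have h1 := hc0 X hX hX0
      have h2 := hc0 Y hY hY0
      refine ⟨?_, by rw [degreeSum_union hd]; exact h1.2.add h2.2⟩
      rw [Finset.card_eq_zero] at *
      rw [Finset.union_inter_distrib_right, h1.1, h2.1, Finset.union_empty]
    · exact hc0 C (Finset.mem_of_mem_erase (Finset.mem_of_mem_erase hC)) (h C hC ▸ hC0)
  by_cases h0 : charge c X = 0 ∨ charge c Y = 0
  · obtain ⟨c', h1, h2, h3⟩ := hP.exists_agreeOn_charge hX hY hXY c true
    rw [if_pos rfl] at h2
    refine ⟨c', h1, hzero c' h3 fun h => ?_, r, ?_⟩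
    · rw [h2] at h
      omega
    · rw [hrest c' h3]
      convert hr using 3
      rw [blockPoly, blockPoly, blockPoly, h2]
      rcases h0 with h0 | h0 <;> simp [h0]
  · rw [not_or] at h0
    set R := ∏ Z ∈ (P.erase X).erase Y, blockPoly c Z with hR
    rw [blockPoly, blockPoly, if_neg h0.1, if_neg h0.2, signPoly_mul, add_mul, map_add] at hr
    have hsign : ∃ s : Bool, evalWeight (posClass r)
        (signPoly (if s then charge c X + charge c Y else charge c X - charge c Y) * R) ≠ 0 := by
      by_contra! h
      have h1 := h true
      have h2 := h false
      simp only [if_true, Bool.false_eq_true, if_false] at h1 h2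
      exact hr (by rw [h1, h2, add_zero])
    obtain ⟨s, hs⟩ := hsign
    obtain ⟨c', h1, h2, h3⟩ := hP.exists_agreeOn_charge hX hY hXY c s
    rw [← h2] at hs
    have hne : charge c' (X ∪ Y) ≠ 0 := by
      intro h
      rw [h, signPoly_zero, zero_mul, map_zero] at hs
      exact hs rfl
    refine ⟨c', h1, hzero c' h3 fun h => absurd h hne, r, ?_⟩
    rwa [hrest c' h3, blockPoly, if_neg hne]

theorem prod_blockPoly_eq_signProd (Q : Finset (Finset V)) (c : V → Bool) :
    ∏ C ∈ Q, blockPoly c C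
      = signProd ((Q.filter fun C => charge c C ≠ 0).val.map (charge c)) := by
  simp only [blockPoly]
  rw [Finset.prod_ite, Finset.prod_const_one, one_mul, signProd, Multiset.map_map]
  rfl

theorem blockPoly_eq_pow {C : Finset V} (h : (charge c C).natAbs ≤ 2) :
    blockPoly c C = signPoly 1 ^ (charge c C).natAbs := by
  rw [blockPoly, ← signPoly_natAbs]
  by_cases h0 : charge c C = 0
  · simp [h0]
  · rw [if_neg h0]
    have : (charge c C).natAbs = 1 ∨ (charge c C).natAbs = 2 := by omega
    rcases this with h | h
    · simp [h]
    · rw [h, signPoly_sq]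
      rfl

/-- The first phase turns into the second when the total weight is `2 * h + 1` or
`2 * h + 3`, where `h` is a power of two. The blocks that avoid `B` contribute a power of
`T + T⁻¹` with exponent at least `h + 4`, from which the factor `T ^ h + T ^ (-h)` splits off. -/
theorem IsAnchored.isSignBalanced (hP : IsBlockPartition T P) (hc : IsAnchored T B P c) {m h δ : ℕ}
    (hh : h = 2 ^ m) (hm : 5 ≤ m) (hB : 20 * B.card ≤ 4 * h) (hδ : δ = 1 ∨ δ = 3)
    (hw : positionWeight P c = 2 * h + δ) : IsSignBalanced T B P c := by
  have h32 : 32 ∣ h := by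
    rw [hh]
    exact pow_dvd_pow 2 hm
  have hpos : 32 ≤ h := Nat.le_of_dvd (by rw [hh]; positivity) h32
  refine ⟨fun C hC h0 => ?_, δ, ?_⟩
  · obtain ⟨h1, h2⟩ := hc C hC
    rw [h0, Int.natAbs_zero] at h1 h2
    have h3 : (C ∩ B).card = 0 := by
      by_contra h3
      have := h2 h3
      omega
    exact ⟨h3, (staticWeight_eq_zero_iff.1 (h1 h3).symm).2⟩
  · set F := P.filter fun C => (C ∩ B).card = 0 with hF
    set A := P.filter fun C => ¬ (C ∩ B).card = 0 with hA
    have hsplit : ∏ C ∈ P, blockPoly c C = (∏ C ∈ F, blockPoly c C) * ∏ C ∈ A, blockPoly c C :=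
      (Finset.prod_filter_mul_prod_filter_not P _ _).symm
    have hwsplit : positionWeight P c
        = (∑ C ∈ F, (charge c C).natAbs) + ∑ C ∈ A, (charge c C).natAbs :=
      (Finset.sum_filter_add_sum_filter_not P _ _).symm
    set N := ∑ C ∈ F, (charge c C).natAbs with hN
    have hFprod : ∏ C ∈ F, blockPoly c C = signPoly 1 ^ N := by
      rw [hN, ← Finset.prod_pow_eq_pow_sum]
      refine Finset.prod_congr rfl fun C hC => blockPoly_eq_pow ?_
      rw [hF, Finset.mem_filter] at hC
      rw [(hc C hC.1).1 hC.2]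
      exact staticWeight_le_two C
    have hAne : ∀ C ∈ A, charge c C ≠ 0 := by
      intro C hC h0
      rw [hA, Finset.mem_filter] at hC
      have := ((hc C hC.1).2 hC.2).1
      rw [h0] at this
      simp at this
    have hAprod : ∏ C ∈ A, blockPoly c C = signProd (A.val.map (charge c)) := by
      rw [prod_blockPoly_eq_signProd, Finset.filter_true_of_mem hAne]
    have hAw : ∑ C ∈ A, (charge c C).natAbs ≤ 4 * B.card := by
      rw [← hP.sum_card_inter B, Finset.mul_sum]
      refine le_trans (Finset.sum_le_sum fun C hC => ?_)
        (Finset.sum_le_sum_of_subset (Finset.filter_subset _ P))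
      rw [hA, Finset.mem_filter] at hC
      exact ((hc C hC.1).2 hC.2).2
    obtain ⟨e, he⟩ : ∃ e, N = h + e := ⟨N - h, by omega⟩
    have hL : signPoly 1 ^ h = signPoly h := by
      rw [hh, signPoly_one_pow_two_pow]
      push_cast
      rfl
    have hprod : ∏ C ∈ P, blockPoly c C
        = signPoly h * signProd (Multiset.replicate e 1 + A.val.map (charge c)) := by
      rw [hsplit, hFprod, hAprod, he, pow_add, hL, mul_assoc]
      simp [signProd]
    rw [hprod, evalWeight_posClass_signPoly_mul ((by norm_num : 8 ∣ 32).trans h32) hδ]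
    · exact one_ne_zero
    · intro a ha
      rcases Multiset.mem_add.1 ha with ha | ha
      · rw [Multiset.eq_of_mem_replicate ha]
        exact one_ne_zero
      · obtain ⟨C, hC, rfl⟩ := Multiset.mem_map.1 ha
        exact hAne C hC
    · rw [Multiset.card_add, Multiset.card_replicate]
      omega
    · have h1 : totalWeight (Multiset.replicate e 1 + A.val.map (charge c))
          = e + ∑ C ∈ A, (charge c C).natAbs := by
        simp only [totalWeight, Multiset.map_add, Multiset.sum_add, Multiset.map_map,
          Multiset.map_replicate, Multiset.sum_replicate]
        simp
      rw [h1]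
      omega

theorem IsAnchored.undecided (hc : IsAnchored T B P c) {h : ℕ}
    (hB : 20 * B.card ≤ 4 * h) (hw : 2 * h + 5 ≤ positionWeight P c) : Undecided P c := by
  refine ⟨?_, fun D hD => ?_⟩
  · by_contra! h0
    have : positionWeight P c = 0 :=
      Finset.sum_eq_zero fun C hC => by rw [h0 C hC, Int.natAbs_zero]
    omega
  · have hsum : (charge c D).natAbs + ∑ X ∈ P.erase D, (charge c X).natAbs
        = positionWeight P c :=
      Finset.add_sum_erase _ (fun X => (charge c X).natAbs) hD
    have hDB : (D ∩ B).card ≤ B.card := Finset.card_le_card Finset.inter_subset_right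
    have hs := staticWeight_le_two (T := T) D
    obtain ⟨h1, h2⟩ := hc D hD
    by_cases h0 : (D ∩ B).card = 0
    · have := h1 h0
      omega
    · have := h2 h0
      omega

theorem IsSignBalanced.undecided (hP : IsBlockPartition T P) (hT : T.IsTree)
    (hn : Odd (Fintype.card V)) {lab : V → V}
    (hlab : ∀ x ∉ B, ∀ y ∉ B, T.Adj x y → lab x = lab y)
    (hk : ∀ g, (Finset.univ.filter fun x => x ∉ B ∧ lab x = g).card < 20)
    (hc : IsSignBalanced T B P c) (h65 : 65 < P.card) : Undecided P c := by
  obtain ⟨hc0, r, hr⟩ := hc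
  have hex : ∃ X ∈ P, charge c X ≠ 0 := by
    by_contra! h0
    have h1 := hP.sum_natAbs_charge_mod_two c
    rw [Finset.sum_eq_zero fun C hC => by rw [h0 C hC, Int.natAbs_zero]] at h1
    obtain ⟨k, hk⟩ := hn
    omega
  refine ⟨hex, fun D hD => ?_⟩
  by_contra! hdom
  have hD0 : charge c D ≠ 0 := by
    intro h
    rw [h] at hdom
    simp at hdom
  have hfew : ((P.erase D).filter fun C => charge c C ≠ 0).card ≤ 3 := by
    by_contra! hmany
    refine hr ?_
    rw [← Finset.mul_prod_erase P _ hD, blockPoly, if_neg hD0, prod_blockPoly_eq_signProd]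
    refine evalWeight_posClass_of_dominated (lt_of_le_of_lt ?_ hdom)
      (by rw [Multiset.card_map]; exact hmany) r
    rw [totalWeight, Multiset.map_map]
    exact Finset.sum_le_sum_of_subset (f := fun X => (charge c X).natAbs)
      (Finset.filter_subset _ (P.erase D))
  have hnonzero : (P.filter fun C => ¬ charge c C = 0).card ≤ 4 := by
    rw [← Finset.insert_erase hD, Finset.filter_insert, if_pos hD0]
    exact (Finset.card_insert_le _ _).trans (Nat.add_le_add_right hfew 1)
  have hzero := hP.card_filter_le hT (by omega) (p := fun C => charge c C = 0) (k := 19) hlab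
    (fun g => Nat.lt_succ_iff.1 (hk g)) hc0
  have hcard := Finset.card_filter_add_card_filter_not (s := P) fun C => charge c C = 0
  omega

theorem SimpleGraph.IsTree.card_le_majorityNumber_add_65 (hT : T.IsTree)
    (hn : Odd (Fintype.card V)) : (Fintype.card V : ℕ∞) ≤ majorityNumber T + 65 := by
  by_cases hsmall : Fintype.card V ≤ 65
  · exact le_add_left (by exact_mod_cast hsmall)
  obtain ⟨t, ht⟩ := hn
  -- The power of two `h` satisfies `2 * h + 1 ≤ n ≤ 4 * h - 1`.
  obtain ⟨m, h, hh, hm, hlow, hhigh⟩ : ∃ m h : ℕ, h = 2 ^ m ∧ 5 ≤ m ∧ h ≤ t ∧ t < 2 * h := by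
    have h1 := Nat.pow_log_le_self 2 (x := t) (by omega)
    have h2 := Nat.lt_pow_succ_log_self (b := 2) (by norm_num) t
    refine ⟨Nat.log 2 t, _, rfl, ?_, h1, by rwa [pow_succ, mul_comm] at h2⟩
    exact Nat.le_log_of_pow_le (by norm_num) (by norm_num; omega)
  obtain ⟨B, lab, hB, hlab, hk⟩ := hT.exists_separator (k := 20) (by norm_num)
  have hB' : 20 * B.card ≤ 4 * h := by omega
  have hpar : ∀ P c, IsBlockPartition T P → positionWeight P c % 2 = 1 := by
    intro P c hP
    rw [positionWeight, hP.sum_natAbs_charge_mod_two]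
    omega
  have hgood : ∀ P c, IsBlockPartition T P → IsAnchored T B P c → 2 * h + 1 ≤ positionWeight P c →
      (IsAnchored T B P c ∧ 2 * h + 5 ≤ positionWeight P c) ∨ IsSignBalanced T B P c := by
    intro P c hP hc hw
    by_cases h5 : 2 * h + 5 ≤ positionWeight P c
    · exact Or.inl ⟨hc, h5⟩
    · have := hpar P c hP
      exact Or.inr (hc.isSignBalanced hP (δ := positionWeight P c - 2 * h) hh hm hB' (by omega)
        (by omega))
  refine card_le_majorityNumber_add (N := 65)
    (fun P c => (IsAnchored T B P c ∧ 2 * h + 5 ≤ positionWeight P c) ∨ IsSignBalanced T B P c)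
    ?_ ?_ (fun _ => true) ?_
  · rintro P c hP (⟨hc, hw⟩ | hc) X hX Y hY hXY u hu v hv huv
    · obtain ⟨c', h1, h2, h3⟩ := hc.exists_mergeBlocks hP hX hY hXY
      exact ⟨c', h1, hgood _ c' (hP.mergeBlocks hX hY hXY hu hv huv) h2 (by omega)⟩
    · obtain ⟨c', h1, h2⟩ := hc.exists_mergeBlocks hP hX hY hXY
      exact ⟨c', h1, Or.inr h2⟩
  · rintro P c hP (⟨hc, hw⟩ | hc) h65
    · exact hc.undecided hB' hw
    · exact hc.undecided hP hT ⟨t, ht⟩ hlab hk h65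
  · refine hgood _ _ isBlockPartition_singletons ?_ ?_
    · intro C hC
      obtain ⟨v, -, rfl⟩ := Finset.mem_image.1 hC
      rw [natAbs_charge_singleton]
      refine ⟨fun _ => by simp [staticWeight], fun h0 => ⟨le_rfl, by omega⟩⟩
    · rw [positionWeight, Finset.sum_congr rfl (g := fun _ => 1), ← Finset.card_eq_sum_ones,
        card_singletons]
      · omega
      · intro C hC
        obtain ⟨v, -, rfl⟩ := Finset.mem_image.1 hC
        exact natAbs_charge_singleton _ v

end OddOrder

theorem theorem1 {V : Type*} [Fintype V] (T : SimpleGraph V) (hT : T.IsTree) :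
    (Even (Fintype.card V) → majorityNumber T = ((Fintype.card V - 1 : ℕ) : ℕ∞)) ∧
    (Odd (Fintype.card V) →
      majorityNumber T ≠ ⊤ ∧ (Fintype.card V : ℕ∞) ≤ majorityNumber T + 65) := by
  classical
  refine ⟨fun hn => le_antisymm hT.majorityNumber_le ?_, fun hn => ⟨?_, ?_⟩⟩
  · have h := hT.card_le_majorityNumber_add_one hn
    push_cast
    exact tsub_le_iff_right.2 h
  · exact ne_top_of_le_ne_top (ENat.natCast_ne_top _) hT.majorityNumber_le
  · exact hT.card_le_majorityNumber_add_65 hn
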